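/- Conventions. A represented space is a set $\mathbf{X}$ with a partial surjection $\delta_{\mathbf{X}} :\subseteq \mathbb{N}^{\mathbb{N}} \to \mathbf{X}$; any $p$ with $\delta_{\mathbf{X}}(p)=x$ is called a name of $x$. A (partial) map between represented spaces is computable if some Type-2 computable partial function on $\mathbb{N}^{\mathbb{N}}$ maps every name of a point of its domain to a name of the image of that point; a computable embedding is a computable injection whose partial inverse is computable. $\mathbf{X}$ carries the final topology of $\delta_{\mathbf{X}}$. $\mathcal{O}(\mathbf{X})$ is the represented space of open subsets of $\mathbf{X}$, identified with the continuous maps from $\mathbf{X}$ to Sierpiński space. $\mathcal{K}(\mathbf{X})$ is the represented space of (saturated) compact subsets, a compact set $K$ being represented as $\{U \in \mathcal{O}(\mathbf{X}) \mid K \subseteq U\} \in \mathcal{O}(\mathcal{O}(\mathbf{X}))$. $(\mathcal{A}\wedge\mathcal{V})(\mathbf{X})$ is the represented space of closed subsets $A$ of $\mathbf{X}$ (including $\emptyset$), a name of $A$ being a pair of a name of $\mathbf{X}\setminus A \in \mathcal{O}(\mathbf{X})$ and a name of $\{U \in \mathcal{O}(\mathbf{X}) \mid A \cap U \neq \emptyset\}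 \in \mathcal{O}(\mathcal{O}(\mathbf{X}))$. An effective relatively compact system (ercs) of $\mathbf{X}$ is a triple $((U_n)_{n\in\mathbb{N}},(B_n)_{n\in\mathbb{N}},R)$ of a computable sequence $(U_n)_{n}$ in $\mathcal{O}(\mathbf{X})$, a computable sequence $(B_n)_{n}$ in $\mathcal{K}(\mathbf{X})$ and a computably enumerable relation $R \subseteq \mathbb{N}\times\mathbb{N}$ such that $(m,n)\in R$ implies $U_m \subseteq B_n$, and such that for every open set $U \subseteq \mathbf{X}$ $$U = \bigcup_{\{n \mid B_n \subseteq U\}}\ \bigcup_{\{m \mid (m,n)\in R\}} U_m .$$ A computable metric space is a metric space $(M,d)$ with a dense sequence $(a_i)_{i\in\mathbb{N}}$ such that $(d(a_i,a_j))_{i,j}$ is a computable double sequence of real numbers; $p$ is a name of $x\in M$ iff $d(a_{p(n)},x)\le 2^{-n}$ for all $n$. A represented space $\mathbf{Y}$ is computably metrizable if there is a metric $d$ on $\mathbf{Y}$ that induces the topology of $\mathbf{Y}$, is computable as a map $d:\mathbf{Y}\times\mathbf{Y}\to\mathbb{R}$, and is effectively compatible with the representation of $\mathbf{Y}$, in the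 sense that some isometric map from $(\mathbf{Y},d)$ into a computable metric space is a computable embedding. Corollary. Let $\mathbf{X}$ be a represented space that admits an ercs. Then $(\mathcal{A}\wedge\mathcal{V})(\mathbf{X})$ is computably metrizable. -/

import Mathlib

open Set
open scoped Topology

universe u v

/-- The finite initial segment `[p 0, …, p (k-1)]` of a point of Baire space. -/
def initSeg (p : ℕ → ℕ) (k : ℕ) : List ℕ := (List.range k).map p

/-- The first half of a pair of points of Baire space, coded by interleaving. -/
def evenPart (p : ℕ → ℕ) : ℕ → ℕ := fun n => p (2 * n)

/-- The second half of a pair of points of Baire space, coded by interleaving. -/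
def oddPart (p : ℕ → ℕ) : ℕ → ℕ := fun n => p (2 * n + 1)

/-- The interleaving of two points of Baire space. -/
def interleave (p q : ℕ → ℕ) : ℕ → ℕ := fun n => if n % 2 = 0 then p (n / 2) else q (n / 2)

theorem evenPart_interleave (p q : ℕ → ℕ) : evenPart (interleave p q) = p := by
  funext n
  simp [evenPart, interleave]

theorem oddPart_interleave (p q : ℕ → ℕ) : oddPart (interleave p q) = q := by
  funext n
  have h1 : (2 * n + 1) % 2 = 1 := by omega
  have h2 : (2 * n + 1) / 2 = n := by omega
  simp [oddPart, interleave, h1, h2]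

/-- `φ` computes `q` from `p`: the `n`-th output digit is the first answer that `φ` gives on
question `n` when it reads longer and longer initial segments of `p`. With a computable `φ`
these are exactly the computable (Type-2) partial functions on Baire space. -/
def Computes (φ : List ℕ × ℕ → Option ℕ) (p q : ℕ → ℕ) : Prop :=
  ∀ n, ∃ k, φ (initSeg p k, n) = some (q n) ∧ ∀ j < k, φ (initSeg p j, n) = none

/-- A represented space: a set `X` with a partial surjection from Baire space onto `X`,
given here by its graph `IsName`. -/
class RepresentedSpace (X : Type u) where
  IsName : (ℕ → ℕ) → X → Prop
  eq_of_isName : ∀ {p : ℕ → ℕ} {x y : X}, IsName p x → IsName p y → x = y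
  exists_isName : ∀ x : X, ∃ p, IsName p x

open RepresentedSpace

/-- The representation as a function on its domain. -/
noncomputable def repMap (X : Type u) [RepresentedSpace X] :
    {p : ℕ → ℕ // ∃ x : X, IsName p x} → X :=
  fun p => p.2.choose

/-- The topology of a represented space: the final topology of the representation, whose
domain carries the subspace topology of Baire space. -/
noncomputable abbrev repTopology (X : Type u) [RepresentedSpace X] : TopologicalSpace X :=
  TopologicalSpace.coinduced (repMap X) inferInstance

theorem initSeg_eq_iff {p q : ℕ → ℕ} {k : ℕ} :
    initSeg q k = initSeg p k ↔ ∀ i < k, q i = p i := by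
  simp [initSeg, List.map_inj_left]

theorem length_initSeg (p : ℕ → ℕ) (k : ℕ) : (initSeg p k).length = k := by
  simp [initSeg]

/-- Openness in terms of names: membership is decided by a finite part of any name. -/
theorem isOpen_repTopology_iff {X : Type u} [RepresentedSpace X] {U : Set X} :
    IsOpen[repTopology X] U ↔ ∀ p (x : X), IsName p x → x ∈ U →
      ∃ k, ∀ q (y : X), initSeg q k = initSeg p k → IsName q y → y ∈ U := by
  have key : ∀ p (x : X) (h : IsName p x), repMap X ⟨p, x, h⟩ = x := fun p x h =>
    eq_of_isName (Exists.choose_spec (⟨x, h⟩ : ∃ x : X, IsName p x)) h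
  rw [repTopology, isOpen_coinduced, isOpen_induced_iff]
  constructor
  · rintro ⟨V, hV, hVU⟩ p x hp hx
    have hmem : ∀ q (y : X), IsName q y → (q ∈ V ↔ y ∈ U) := by
      intro q y hq
      have := Set.ext_iff.1 hVU ⟨q, y, hq⟩
      simpa [key q y hq] using this
    obtain ⟨I, u, hu, hsub⟩ := isOpen_pi_iff.1 hV p ((hmem p x hp).2 hx)
    refine ⟨I.sup id + 1, fun q y hqp hq => (hmem q y hq).1 (hsub ?_)⟩
    intro i hi
    have hik : i < I.sup id + 1 := Nat.lt_succ_of_le (Finset.le_sup (f := id) hi)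
    rw [initSeg_eq_iff.1 hqp i hik]
    exact (hu i hi).2
  · intro h
    refine ⟨{p | ∃ k, ∀ q (y : X), initSeg q k = initSeg p k → IsName q y → y ∈ U}, ?_, ?_⟩
    · rw [isOpen_pi_iff]
      rintro p ⟨k, hk⟩
      refine ⟨Finset.range k, fun i => {p i}, fun i _ => ⟨isOpen_discrete _, rfl⟩, ?_⟩
      intro p' hp'
      refine ⟨k, fun q y hq => hk q y (hq.trans (initSeg_eq_iff.2 fun i hi => ?_))⟩
      exact hp' i (by simpa using hi)
    · ext ⟨p, x, hp⟩
      simp only [mem_preimage, mem_ofPred_eq, key p x hp]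
      exact ⟨fun ⟨k, hk⟩ => hk p x rfl hp, fun hx => h p x hp hx⟩

/-- `f : X → Y` is computable: some computable functional maps every name of a point `x` to
a name of `f x`. -/
def ComputableMap {X : Type u} {Y : Type v} [RepresentedSpace X] [RepresentedSpace Y]
    (f : X → Y) : Prop :=
  ∃ φ : List ℕ × ℕ → Option ℕ, Computable φ ∧
    ∀ p x, IsName p x → ∃ q, Computes φ p q ∧ IsName q (f x)

/-- `f : X → Y` is a computable embedding: it is injective and computable, and its partial
inverse, defined on the range of `f`, is computable. -/
def ComputableEmbedding {X : Type u} {Y : Type v} [RepresentedSpace X] [RepresentedSpace Y]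
    (f : X → Y) : Prop :=
  Function.Injective f ∧ ComputableMap f ∧
    ∃ φ : List ℕ × ℕ → Option ℕ, Computable φ ∧
      ∀ p x, IsName p (f x) → ∃ q, Computes φ p q ∧ IsName q x

/-- A computable sequence of points: names of its members can be computed uniformly. -/
def ComputableSeq {X : Type u} [RepresentedSpace X] (s : ℕ → X) : Prop :=
  ∃ f : ℕ → ℕ → ℕ, Computable₂ f ∧ ∀ n, IsName (f n) (s n)

/-- The product of represented spaces. -/
instance instRepresentedSpaceProd {X : Type u} {Y : Type v} [RepresentedSpace X]
    [RepresentedSpace Y] : RepresentedSpace (X × Y) where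
  IsName p z := IsName (evenPart p) z.1 ∧ IsName (oddPart p) z.2
  eq_of_isName h h' := Prod.ext (eq_of_isName h.1 h'.1) (eq_of_isName h.2 h'.2)
  exists_isName z := by
    obtain ⟨p, hp⟩ := exists_isName z.1
    obtain ⟨q, hq⟩ := exists_isName z.2
    exact ⟨interleave p q, by rwa [evenPart_interleave], by rwa [oddPart_interleave]⟩

/-- The points of the hyperspace of open subsets of `X`. -/
@[ext]
structure OpenSet (X : Type u) [RepresentedSpace X] where
  carrier : Set X
  isOpen' : IsOpen[repTopology X] carrier

/-- The represented space of open sets, that is, of continuous maps from `X` to Sierpiński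
space: a name of `U` tells for finite initial segments of names of points whether they are
accepted, and a point is in `U` iff some initial segment of its name is accepted. -/
instance instRepresentedSpaceOpenSet {X : Type u} [RepresentedSpace X] :
    RepresentedSpace (OpenSet X) where
  IsName p U := ∀ q (x : X), IsName q x →
    (x ∈ U.carrier ↔ ∃ k, p (Encodable.encode (initSeg q k)) ≠ 0)
  eq_of_isName {p U V} hU hV := by
    ext x
    obtain ⟨q, hq⟩ := exists_isName x
    rw [hU q x hq, hV q x hq]
  exists_isName U := by
    classical
    refine ⟨fun c => if ∃ w : List ℕ, Encodable.encode w = c ∧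
      ∀ q (y : X), initSeg q w.length = w → IsName q y → y ∈ U.carrier then 1 else 0, ?_⟩
    intro q x hq
    constructor
    · intro hx
      obtain ⟨k, hk⟩ := isOpen_repTopology_iff.1 U.isOpen' q x hq hx
      refine ⟨k, ?_⟩
      dsimp only
      rw [if_pos ⟨initSeg q k, rfl, by rwa [length_initSeg]⟩]
      exact one_ne_zero
    · rintro ⟨k, hk⟩
      rw [ne_eq, ite_eq_right_iff, Classical.not_imp] at hk
      obtain ⟨⟨w, hw, h⟩, -⟩ := hk
      obtain rfl := Encodable.encode_injective hw
      exact h q x (by rw [length_initSeg]) hq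

/-- The points of the hyperspace of compact subsets of `X`: the saturated sets `K` for which
`{U | K ⊆ U}` is an open set of open sets. (A set and its saturation, the intersection of
its open supersets, have the same open supersets and are identified.) -/
@[ext]
structure CompactSet (X : Type u) [RepresentedSpace X] where
  carrier : Set X
  saturated' : ∀ x, (∀ U : OpenSet X, carrier ⊆ U.carrier → x ∈ U.carrier) → x ∈ carrier
  isOpen_supersets : IsOpen[repTopology (OpenSet X)] {U : OpenSet X | carrier ⊆ U.carrier}

/-- The open set of open supersets of a compact set. -/
def CompactSet.supersets {X : Type u} [RepresentedSpace X] (K : CompactSet X) :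
    OpenSet (OpenSet X) :=
  ⟨{U | K.carrier ⊆ U.carrier}, K.isOpen_supersets⟩

/-- The represented space of compact sets. -/
instance instRepresentedSpaceCompactSet {X : Type u} [RepresentedSpace X] :
    RepresentedSpace (CompactSet X) where
  IsName p K := IsName p K.supersets
  eq_of_isName {p K L} hK hL := by
    have h : ∀ U : OpenSet X, K.carrier ⊆ U.carrier ↔ L.carrier ⊆ U.carrier := fun U =>
      Set.ext_iff.1 (congrArg OpenSet.carrier (eq_of_isName hK hL)) U
    ext x
    exact ⟨fun hx => L.saturated' x fun U hU => (h U).2 hU hx,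
      fun hx => K.saturated' x fun U hU => (h U).1 hU hx⟩
  exists_isName K := exists_isName K.supersets

/-- The points of the hyperspace of closed-and-overt subsets of `X`: the closed sets. -/
@[ext]
structure ClosedOvert (X : Type u) [RepresentedSpace X] where
  carrier : Set X
  isClosed' : IsClosed[repTopology X] carrier

/-- The complement of a closed set, as an open set. -/
def ClosedOvert.compl {X : Type u} [RepresentedSpace X] (A : ClosedOvert X) : OpenSet X :=
  ⟨A.carrierᶜ, (@isOpen_compl_iff X A.carrier (repTopology X)).2 A.isClosed'⟩

/-- The open set of all open sets that intersect `A`. -/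
def ClosedOvert.hits {X : Type u} [RepresentedSpace X] (A : ClosedOvert X) :
    OpenSet (OpenSet X) :=
  ⟨{U | (A.carrier ∩ U.carrier).Nonempty}, by
    rw [isOpen_repTopology_iff]
    rintro p U hp ⟨x, hxA, hxU⟩
    obtain ⟨r, hr⟩ := exists_isName x
    obtain ⟨k, hk⟩ := (hp r x hr).1 hxU
    refine ⟨Encodable.encode (initSeg r k) + 1, fun q V hqp hq => ⟨x, hxA, ?_⟩⟩
    refine (hq r x hr).2 ⟨k, ?_⟩
    rwa [initSeg_eq_iff.1 hqp _ (Nat.lt_succ_self _)]⟩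

/-- The represented space of closed-and-overt sets: a name of `A` is a pair of a name of `A`
as a closed set (that is, of the complement of `A` as an open set) and a name of `A` as an
overt set (that is, of the open set of all open sets that intersect `A`). -/
instance instRepresentedSpaceClosedOvert {X : Type u} [RepresentedSpace X] :
    RepresentedSpace (ClosedOvert X) where
  IsName p A := IsName (evenPart p) A.compl ∧ IsName (oddPart p) A.hits
  eq_of_isName {p A B} hA hB := by
    have h := congrArg OpenSet.carrier (eq_of_isName hA.1 hB.1)
    exact ClosedOvert.ext (compl_injective h)
  exists_isName A := by
    obtain ⟨p, hp⟩ := exists_isName A.compl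
    obtain ⟨q, hq⟩ := exists_isName A.hits
    exact ⟨interleave p q, by rwa [evenPart_interleave], by rwa [oddPart_interleave]⟩

/-- An effective relatively compact system of a represented space. -/
structure ERCS (X : Type u) [RepresentedSpace X] where
  U : ℕ → OpenSet X
  B : ℕ → CompactSet X
  R : ℕ × ℕ → Prop
  computable_U : ComputableSeq U
  computable_B : ComputableSeq B
  re_R : REPred R
  subset_of_R : ∀ m n, R (m, n) → (U m).carrier ⊆ (B n).carrier
  eq_iUnion : ∀ V : OpenSet X,
    V.carrier = ⋃ n ∈ {n | (B n).carrier ⊆ V.carrier}, ⋃ m ∈ {m | R (m, n)}, (U m).carrier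

/-- A numbering of the rational numbers. -/
def ratOfCode (c : ℕ) : ℚ :=
  ((c.unpair.1.unpair.1 : ℚ) - (c.unpair.1.unpair.2 : ℚ)) / ((c.unpair.2 : ℚ) + 1)

theorem ratOfCode_surjective : Function.Surjective ratOfCode := by
  intro r
  refine ⟨Nat.pair (Nat.pair r.num.toNat (-r.num).toNat) (r.den - 1), ?_⟩
  have h1 : ((r.num.toNat : ℚ) - ((-r.num).toNat : ℚ)) = (r.num : ℚ) := by
    have : ((r.num.toNat : ℤ) - ((-r.num).toNat : ℤ)) = r.num := by omega
    exact_mod_cast this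
  have h2 : (((r.den - 1 : ℕ) : ℚ) + 1) = (r.den : ℚ) := by
    have : r.den - 1 + 1 = r.den := Nat.sub_add_cancel r.den_pos
    exact_mod_cast this
  simp only [ratOfCode, Nat.unpair_pair]
  rw [h1, h2, Rat.num_div_den]

/-- The real numbers, represented by fast converging sequences of rational numbers. -/
instance instRepresentedSpaceReal : RepresentedSpace ℝ where
  IsName p x := ∀ n, |(ratOfCode (p n) : ℝ) - x| ≤ (1 / 2) ^ n
  eq_of_isName {p x y} hx hy := by
    refine tendsto_nhds_unique (f := fun n => (ratOfCode (p n) : ℝ)) (l := Filter.atTop) ?_ ?_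
    · exact tendsto_iff_dist_tendsto_zero.2 (squeeze_zero (fun _ => dist_nonneg)
        (fun n => (Real.dist_eq _ _).trans_le (hx n))
        (tendsto_pow_atTop_nhds_zero_of_lt_one (by norm_num) (by norm_num)))
    · exact tendsto_iff_dist_tendsto_zero.2 (squeeze_zero (fun _ => dist_nonneg)
        (fun n => (Real.dist_eq _ _).trans_le (hy n))
        (tendsto_pow_atTop_nhds_zero_of_lt_one (by norm_num) (by norm_num)))
  exists_isName x := by
    have h : ∀ n : ℕ, ∃ c, |(ratOfCode c : ℝ) - x| ≤ (1 / 2) ^ n := by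
      intro n
      obtain ⟨r, hr1, hr2⟩ := exists_rat_btwn
        (show x < x + (1 / 2 : ℝ) ^ n from lt_add_of_pos_right _ (by positivity))
      obtain ⟨c, rfl⟩ := ratOfCode_surjective r
      exact ⟨c, by rw [abs_le]; constructor <;> linarith⟩
    choose p hp using h
    exact ⟨p, hp⟩

/-- A computable metric space: a metric space with a dense sequence whose distances form a
computable double sequence of real numbers. -/
class ComputableMetricSpace (M : Type u) extends MetricSpace M where
  pts : ℕ → M
  denseRange_pts : DenseRange pts
  computable_dist : ∃ f : ℕ × ℕ × ℕ → ℕ, Computable f ∧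
    ∀ i j n, |(ratOfCode (f (i, j, n)) : ℝ) - dist (pts i) (pts j)| ≤ (1 / 2) ^ n

/-- The Cauchy representation of a computable metric space: points are named by fast
converging sequences in the distinguished dense sequence. -/
instance instRepresentedSpaceOfMetric {M : Type u} [ComputableMetricSpace M] :
    RepresentedSpace M where
  IsName p x := ∀ n, dist (ComputableMetricSpace.pts (p n)) x ≤ (1 / 2) ^ n
  eq_of_isName {p x y} hx hy := by
    refine tendsto_nhds_unique (f := fun n => (ComputableMetricSpace.pts (p n) : M))
      (l := Filter.atTop) ?_ ?_
    · exact tendsto_iff_dist_tendsto_zero.2 (squeeze_zero (fun _ => dist_nonneg) hx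
        (tendsto_pow_atTop_nhds_zero_of_lt_one (by norm_num) (by norm_num)))
    · exact tendsto_iff_dist_tendsto_zero.2 (squeeze_zero (fun _ => dist_nonneg) hy
        (tendsto_pow_atTop_nhds_zero_of_lt_one (by norm_num) (by norm_num)))
  exists_isName x := by
    have h : ∀ n : ℕ, ∃ i, dist (ComputableMetricSpace.pts i) x ≤ (1 / 2) ^ n := by
      intro n
      obtain ⟨i, hi⟩ := ComputableMetricSpace.denseRange_pts.exists_dist_lt x
        (show (0 : ℝ) < (1 / 2) ^ n by positivity)
      exact ⟨i, by rw [dist_comm]; exact hi.le⟩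
    choose p hp using h
    exact ⟨p, hp⟩

/-- A represented space is computably metrizable if it admits a metric that is computable and
is effectively compatible with the space: it induces the topology, and the names are, up to
computable translation, the Cauchy names for that metric. As a metric space alone need not
have any computable points, the latter means that the space is, isometrically and by a
computable embedding, a subspace of a computable metric space. -/
def ComputablyMetrizable (X : Type u) [RepresentedSpace X] : Prop :=
  ∃ m : MetricSpace X,
    m.toUniformSpace.toTopologicalSpace = repTopology X ∧
    ComputableMap (fun z : X × X => m.dist z.1 z.2) ∧
    ∃ (M : Type) (_ : ComputableMetricSpace M) (ι : X → M),
      (∀ x y : X, dist (ι x) (ι y) = m.dist x y) ∧ ComputableEmbedding ι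

/-!
The proof embeds the hyperspace of closed-and-overt sets computably into the Hilbert cube; the
metric is the one induced from there.

For a finite list `F` of indices and an open set `V` write `F ≪ V` if each `U m` with `m ∈ F` is,
by the relation of the system, formally contained in some `B n ⊆ V`. Since the `B n` are
computably compact, this is semidecidable in a name of `V`, and compactness also yields
interpolation: `F ≪ V` implies `F ≪ ⋃ G` and `G ≪ V` for some finite list `G`
(`ERCS.WayBelow.interpolate`). The pairs `F ≪ ⋃ G` can be enumerated, and interpolating elements
can be found by search, so that each pair computably spawns dyadic chains as in the proof of
Urysohn's lemma (`ERCS.InterpolationSystem.chain`). The resulting function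
`ERCS.InterpolationSystem.urysohn` on the hyperspace vanishes at the sets `A` that hit `⋃ F` and
is `1` at those that miss `⋃ G`. Its value at `A` is computable from a name of `A`: upper
bounds are witnessed by a member of the chain that `A` hits, and lower bounds by a member that is
way below the complement of `A`.

The scaled Urysohn functions of all pairs are the coordinates of the embedding. Its inverse is
computable because `x ∉ A` holds iff `x ∈ ⋃ F` for some pair whose function is positive at `A`, and
`A` hits `V` iff `G ≪ V` for some pair whose function is less than `1` at `A`
(`ERCS.InterpolationSystem.mem_compl_iff`, `ERCS.InterpolationSystem.mem_hits_iff`). Finally,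
each computable embedding into a computable metric space makes its domain computably metrizable
(`ComputableEmbedding.computablyMetrizable`); in particular the induced topology is the final
topology of the representation.

Computability is handled through recursively enumerable predicates: to compute a point, it
suffices to enumerate, from beginnings of the input, the correct answers to each question
(`REPred.exists_computes`), and the required enumerability follows from closure properties of
`REPred` that are registered with `fun_prop`.
-/

/-! ### Computable functions and predicates -/

attribute [fun_prop] Computable ComputablePred REPred
attribute [fun_prop] Computable.id Computable.const Computable.comp

section Computability

variable {α β γ : Type*} [Primcodable α] [Primcodable β] [Primcodable γ]

namespace Computable

@[fun_prop]
theorem comp_fst {f : α → β × γ} (hf : Computable f) : Computable fun a => (f a).1 :=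
  Computable.fst.comp hf

@[fun_prop]
theorem comp_snd {f : α → β × γ} (hf : Computable f) : Computable fun a => (f a).2 :=
  Computable.snd.comp hf

@[fun_prop]
theorem comp_mk {f : α → β} {g : α → γ} (hf : Computable f) (hg : Computable g) :
    Computable fun a => (f a, g a) :=
  hf.pair hg

@[fun_prop]
theorem comp_add {f g : α → ℕ} (hf : Computable f) (hg : Computable g) :
    Computable fun a => f a + g a :=
  Primrec.nat_add.to_comp.comp hf hg

@[fun_prop]
theorem comp_sub {f g : α → ℕ} (hf : Computable f) (hg : Computable g) :
    Computable fun a => f a - g a :=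
  Primrec.nat_sub.to_comp.comp hf hg

@[fun_prop]
theorem comp_mul {f g : α → ℕ} (hf : Computable f) (hg : Computable g) :
    Computable fun a => f a * g a :=
  Primrec.nat_mul.to_comp.comp hf hg

@[fun_prop]
theorem comp_div {f g : α → ℕ} (hf : Computable f) (hg : Computable g) :
    Computable fun a => f a / g a :=
  Primrec.nat_div.to_comp.comp hf hg

@[fun_prop]
theorem comp_mod {f g : α → ℕ} (hf : Computable f) (hg : Computable g) :
    Computable fun a => f a % g a :=
  Primrec.nat_mod.to_comp.comp hf hg

@[fun_prop]
theorem comp_min {f g : α → ℕ} (hf : Computable f) (hg : Computable g) :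
    Computable fun a => min (f a) (g a) :=
  Primrec.nat_min.to_comp.comp hf hg

@[fun_prop]
theorem comp_max {f g : α → ℕ} (hf : Computable f) (hg : Computable g) :
    Computable fun a => max (f a) (g a) :=
  Primrec.nat_max.to_comp.comp hf hg

@[fun_prop]
theorem comp_pow {f g : α → ℕ} (hf : Computable f) (hg : Computable g) :
    Computable fun a => f a ^ g a :=
  (Primrec₂.unpaired'.1 Nat.Primrec.pow).to_comp.comp hf hg

@[fun_prop]
theorem comp_natPair {f g : α → ℕ} (hf : Computable f) (hg : Computable g) :
    Computable fun a => Nat.pair (f a) (g a) :=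
  Primrec₂.natPair.to_comp.comp hf hg

@[fun_prop]
theorem comp_unpair {f : α → ℕ} (hf : Computable f) : Computable fun a => (f a).unpair :=
  Computable.unpair.comp hf

@[fun_prop]
theorem comp_encode {f : α → β} (hf : Computable f) :
    Computable fun a => Encodable.encode (f a) :=
  Computable.encode.comp hf

@[fun_prop]
theorem comp_ofNat {β : Type*} [Denumerable β] {f : α → ℕ} (hf : Computable f) :
    Computable fun a => Denumerable.ofNat β (f a) :=
  (Computable.ofNat β).comp hf

@[fun_prop]
theorem comp_some {f : α → β} (hf : Computable f) : Computable fun a => some (f a) :=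
  Computable.option_some.comp hf

@[fun_prop]
theorem comp_length {f : α → List β} (hf : Computable f) : Computable fun a => (f a).length :=
  Computable.list_length.comp hf

@[fun_prop]
theorem comp_getD {f : α → List ℕ} {g : α → ℕ} (hf : Computable f) (hg : Computable g) :
    Computable fun a => (f a).getD (g a) 0 :=
  (Primrec.list_getD 0).to_comp.comp hf hg

@[fun_prop]
theorem comp_take {f : α → ℕ} {g : α → List β} (hf : Computable f) (hg : Computable g) :
    Computable fun a => (g a).take (f a) :=
  Primrec.list_take.to_comp.comp hf hg

@[fun_prop]
theorem comp_ite {c : α → Prop} [DecidablePred c] {f g : α → β} (hc : ComputablePred c)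
    (hf : Computable f) (hg : Computable g) : Computable fun a => if c a then f a else g a :=
  (hc.decide.cond hf hg).of_eq fun a => by by_cases h : c a <;> simp [h]

/-- Primitive recursion along a computable step function. -/
theorem comp_natRec {N : α → ℕ} {f : α → β} {g : α → ℕ → β → β} (hN : Computable N)
    (hf : Computable f) (hg : Computable fun p : α × ℕ × β => g p.1 p.2.1 p.2.2) :
    Computable fun a => Nat.rec (motive := fun _ => β) (f a) (g a) (N a) :=
  Computable.nat_rec hN hf (h := fun a p => g a p.1 p.2) hg

@[fun_prop]
theorem comp_initSeg {N : α → ℕ} {f : α → ℕ → ℕ} (hN : Computable N)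
    (hf : Computable fun p : α × ℕ => f p.1 p.2) : Computable fun a => initSeg (f a) (N a) := by
  have h : Computable fun a => Nat.rec (motive := fun _ => List ℕ) []
      (fun i l => l ++ [f a i]) (N a) :=
    comp_natRec hN (Computable.const _)
      (Computable.list_concat.comp (by fun_prop) (by fun_prop))
  refine h.of_eq fun a => ?_
  induction N a with
  | zero => rfl
  | succ n ih => simp_all [initSeg, List.range_succ]

theorem comp_sum {N : α → ℕ} {f : α → ℕ → ℕ} (hN : Computable N)
    (hf : Computable fun p : α × ℕ => f p.1 p.2) :
    Computable fun a => ∑ i ∈ Finset.range (N a), f a i := by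
  have h : Computable fun a => Nat.rec (motive := fun _ => ℕ) 0 (fun i l => l + f a i) (N a) :=
    comp_natRec hN (Computable.const _) (by fun_prop)
  refine h.of_eq fun a => ?_
  induction N a with
  | zero => rfl
  | succ n ih => simp_all [Finset.sum_range_succ]

theorem comp_sup {N : α → ℕ} {f : α → ℕ → ℕ} (hN : Computable N)
    (hf : Computable fun p : α × ℕ => f p.1 p.2) :
    Computable fun a => (Finset.range (N a)).sup (f a) := by
  have h : Computable fun a => Nat.rec (motive := fun _ => ℕ) 0 (fun i l => max (f a i) l) (N a) :=
    comp_natRec hN (Computable.const _) (by fun_prop)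
  refine h.of_eq fun a => ?_
  induction N a with
  | zero => rfl
  | succ n ih => simp_all [Finset.range_add_one]

end Computable

namespace ComputablePred

@[fun_prop]
theorem comp {P : β → Prop} {f : α → β} (hP : ComputablePred P) (hf : Computable f) :
    ComputablePred fun a => P (f a) := by
  obtain ⟨_, hP⟩ := hP
  exact ⟨fun _ => inferInstance, hP.comp hf⟩

@[fun_prop]
theorem comp_and {P Q : α → Prop} (hP : ComputablePred P) (hQ : ComputablePred Q) :
    ComputablePred fun a => P a ∧ Q a := by
  obtain ⟨_, hP⟩ := hP
  obtain ⟨_, hQ⟩ := hQ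
  exact ⟨fun _ => inferInstance, (Primrec.and.to_comp.comp hP hQ).of_eq fun a => by simp⟩

@[fun_prop]
theorem comp_or {P Q : α → Prop} (hP : ComputablePred P) (hQ : ComputablePred Q) :
    ComputablePred fun a => P a ∨ Q a := by
  obtain ⟨_, hP⟩ := hP
  obtain ⟨_, hQ⟩ := hQ
  exact ⟨fun _ => inferInstance, (Primrec.or.to_comp.comp hP hQ).of_eq fun a => by simp⟩

attribute [fun_prop] ComputablePred.not

@[fun_prop]
theorem comp_eq {f g : α → β} (hf : Computable f) (hg : Computable g) :
    ComputablePred fun a => f a = g a := by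
  classical
  exact ⟨fun _ => inferInstance, (Primrec.eq.decide.to_comp.comp hf hg).of_eq fun a => rfl⟩

@[fun_prop]
theorem comp_ne {f g : α → β} (hf : Computable f) (hg : Computable g) :
    ComputablePred fun a => f a ≠ g a :=
  (comp_eq hf hg).not

@[fun_prop]
theorem comp_lt {f g : α → ℕ} (hf : Computable f) (hg : Computable g) :
    ComputablePred fun a => f a < g a :=
  ⟨fun _ => inferInstance, (Primrec.nat_lt.decide.to_comp.comp hf hg).of_eq fun _ => rfl⟩

@[fun_prop]
theorem comp_le {f g : α → ℕ} (hf : Computable f) (hg : Computable g) :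
    ComputablePred fun a => f a ≤ g a :=
  ⟨fun _ => inferInstance, (Primrec.nat_le.decide.to_comp.comp hf hg).of_eq fun _ => rfl⟩

@[fun_prop]
theorem comp_ball {N : α → ℕ} {P : α → ℕ → Prop} (hN : Computable N)
    (hP : ComputablePred fun p : α × ℕ => P p.1 p.2) :
    ComputablePred fun a => ∀ i < N a, P a i := by
  classical
  have hP' : Computable fun p : α × ℕ => decide (P p.1 p.2) := hP.decide
  refine ⟨fun _ => inferInstance, ?_⟩
  have h : Computable fun a => Nat.rec (motive := fun _ => Bool) true
      (fun i b => b && decide (P a i)) (N a) :=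
    Computable.comp_natRec hN (Computable.const _)
      (Primrec.and.to_comp.comp (by fun_prop) (hP'.comp (f := fun p : α × ℕ => decide (P p.1 p.2))
          (g := fun p : α × ℕ × Bool => (p.1, p.2.1)) (by fun_prop)))
  refine h.of_eq fun a => ?_
  rw [Bool.eq_iff_iff, decide_eq_true_iff]
  dsimp only
  induction N a with
  | zero => simp
  | succ n ih => simp only [Bool.and_eq_true, ih, Nat.lt_succ_iff_lt_or_eq, or_imp, forall_and,
      decide_eq_true_eq, forall_eq]

@[fun_prop]
theorem comp_bex {N : α → ℕ} {P : α → ℕ → Prop} (hN : Computable N)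
    (hP : ComputablePred fun p : α × ℕ => P p.1 p.2) :
    ComputablePred fun a => ∃ i < N a, P a i := by
  have h : ComputablePred fun a => ¬ ∀ i < N a, ¬ P a i := (comp_ball hN hP.not).not
  exact h.of_eq fun a => by push Not; rfl

end ComputablePred

namespace REPred

@[fun_prop]
theorem comp {P : β → Prop} {f : α → β} (hP : REPred P) (hf : Computable f) :
    REPred fun a => P (f a) :=
  Partrec.comp hP hf

/-- A recursively enumerable predicate is the projection of a computable one: the witness is
the number of steps that a machine needs to accept. -/
theorem exists_computablePred {P : α → Prop} (hP : REPred P) :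
    ∃ D : α × ℕ → Prop, ComputablePred D ∧ ∀ a, P a ↔ ∃ t, D (a, t) := by
  obtain ⟨c, hc⟩ := Nat.Partrec.Code.exists_code.1 hP
  refine ⟨fun p => (Nat.Partrec.Code.evaln p.2 c (Encodable.encode p.1)).isSome = true,
    ⟨fun _ => inferInstance, ?_⟩, fun a => ?_⟩
  · have h : Computable fun p : α × ℕ =>
        (Nat.Partrec.Code.evaln p.2 c (Encodable.encode p.1)).isSome :=
      Primrec.option_isSome.to_comp.comp (Nat.Partrec.Code.primrec_evaln.to_comp.comp
        (f := fun a : (ℕ × Nat.Partrec.Code) × ℕ => Nat.Partrec.Code.evaln a.1.1 a.1.2 a.2)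
        (g := fun p : α × ℕ => ((p.2, c), Encodable.encode p.1)) (by fun_prop))
    exact h.of_eq fun p => by simp
  · have h1 : P a ↔ (Nat.Partrec.Code.eval c (Encodable.encode a)).Dom := by
      rw [hc]
      simp [Part.assert]
    rw [h1, Part.dom_iff_mem]
    simp only [Nat.Partrec.Code.evaln_complete, Option.isSome_iff_exists, Option.mem_def]
    exact exists_comm

theorem exists_of_computablePred {D : α → ℕ → Prop}
    (hD : ComputablePred fun p : α × ℕ => D p.1 p.2) : REPred fun a => ∃ t, D a t := by
  classical
  have h : Partrec fun a => Nat.rfind fun n => Part.some (decide (D a n)) :=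
    Partrec.rfind hD.decide.partrec
  refine h.dom_re.of_eq fun a => Nat.rfind_dom'.trans ?_
  simp

@[fun_prop]
theorem comp_exists {P : α → ℕ → Prop} (hP : REPred fun p : α × ℕ => P p.1 p.2) :
    REPred fun a => ∃ n, P a n := by
  obtain ⟨D, hD, h⟩ := hP.exists_computablePred
  refine (exists_of_computablePred (D := fun a n => D ((a, n.unpair.1), n.unpair.2))
    (by fun_prop)).of_eq fun a => ⟨?_, ?_⟩
  · rintro ⟨n, hn⟩
    exact ⟨n.unpair.1, (h (a, _)).2 ⟨_, hn⟩⟩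
  · rintro ⟨n, hn⟩
    obtain ⟨t, ht⟩ := (h (a, n)).1 hn
    exact ⟨Nat.pair n t, by simpa using ht⟩

@[fun_prop]
theorem comp_and {P Q : α → Prop} (hP : REPred P) (hQ : REPred Q) :
    REPred fun a => P a ∧ Q a := by
  obtain ⟨D, hD, h⟩ := hP.exists_computablePred
  obtain ⟨E, hE, h'⟩ := hQ.exists_computablePred
  refine (comp_exists (P := fun a n => ∃ m, D (a, n) ∧ E (a, m))
    (exists_of_computablePred (by fun_prop))).of_eq fun a => ?_
  simp [h, h']

@[fun_prop]
theorem comp_or {P Q : α → Prop} (hP : REPred P) (hQ : REPred Q) :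
    REPred fun a => P a ∨ Q a := by
  obtain ⟨D, hD, h⟩ := hP.exists_computablePred
  obtain ⟨E, hE, h'⟩ := hQ.exists_computablePred
  refine (exists_of_computablePred (D := fun a n => D (a, n) ∨ E (a, n))
    (by fun_prop)).of_eq fun a => ?_
  simp [h, h', exists_or]

@[fun_prop]
theorem comp_ball {N : α → ℕ} {P : α → ℕ → Prop} (hN : Computable N)
    (hP : REPred fun p : α × ℕ => P p.1 p.2) : REPred fun a => ∀ i < N a, P a i := by
  obtain ⟨D, hD, h⟩ := hP.exists_computablePred
  refine (exists_of_computablePred (D := fun a T => ∀ i < N a, ∃ t < T, D ((a, i), t))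
    (ComputablePred.comp_ball (by fun_prop)
      (ComputablePred.comp_bex (by fun_prop) (by fun_prop)))).of_eq fun a => ⟨?_, ?_⟩
  · rintro ⟨T, hT⟩ i hi
    obtain ⟨t, -, ht⟩ := hT i hi
    exact (h (a, i)).2 ⟨t, ht⟩
  · intro H
    choose! t ht using fun i hi => (h (a, i)).1 (H i hi)
    exact ⟨(Finset.range (N a)).sup t + 1, fun i hi => ⟨t i, Nat.lt_succ_of_le
      (Finset.le_sup (f := t) (Finset.mem_range.2 hi)), ht i hi⟩⟩

@[fun_prop]
theorem comp_bex {N : α → ℕ} {P : α → ℕ → Prop} (hN : Computable N)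
    (hP : REPred fun p : α × ℕ => P p.1 p.2) : REPred fun a => ∃ i < N a, P a i :=
  comp_exists ((ComputablePred.comp_lt (by fun_prop) (by fun_prop)).to_re.comp_and hP)

@[fun_prop]
theorem comp_eq {f g : α → β} (hf : Computable f) (hg : Computable g) :
    REPred fun a => f a = g a :=
  (ComputablePred.comp_eq hf hg).to_re

@[fun_prop]
theorem comp_ne {f g : α → β} (hf : Computable f) (hg : Computable g) :
    REPred fun a => f a ≠ g a :=
  (ComputablePred.comp_ne hf hg).to_re

@[fun_prop]
theorem comp_lt {f g : α → ℕ} (hf : Computable f) (hg : Computable g) :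
    REPred fun a => f a < g a :=
  (ComputablePred.comp_lt hf hg).to_re

/-- Uniformization: a total recursively enumerable relation contains the graph of a computable
function. -/
theorem exists_computable_choice {P : α × ℕ → Prop} (hP : REPred P) (h : ∀ a, ∃ n, P (a, n)) :
    ∃ f : α → ℕ, Computable f ∧ ∀ a, P (a, f a) := by
  classical
  obtain ⟨D, hD, hPD⟩ := hP.exists_computablePred
  have hex : ∀ a, ∃ n : ℕ, D ((a, n.unpair.1), n.unpair.2) := fun a => by
    obtain ⟨n, hn⟩ := h a
    obtain ⟨t, ht⟩ := (hPD _).1 hn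
    exact ⟨Nat.pair n t, by simpa using ht⟩
  refine ⟨fun a => (Nat.find (hex a)).unpair.1, ?_, fun a =>
    (hPD _).2 ⟨_, Nat.find_spec (hex a)⟩⟩
  have := Computable.find (P := fun (a : α) n => D ((a, n.unpair.1), n.unpair.2)) (by fun_prop) hex
  fun_prop

end REPred

end Computability

/-! ### Computable functionals on Baire space -/

section Functionals

theorem take_initSeg (p : ℕ → ℕ) (j k : ℕ) : (initSeg p k).take j = initSeg p (min j k) := by
  simp [initSeg, ← List.map_take, List.take_range]

theorem getD_initSeg {p : ℕ → ℕ} {i k : ℕ} (h : i < k) : (initSeg p k).getD i 0 = p i := by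
  simp [initSeg, List.getD_eq_getElem?_getD, h]

/-- The digits of a word at even positions. -/
def evenWord (u : List ℕ) : List ℕ := initSeg (fun i => u.getD (2 * i) 0) (u.length / 2)

/-- The digits of a word at odd positions. -/
def oddWord (u : List ℕ) : List ℕ := initSeg (fun i => u.getD (2 * i + 1) 0) (u.length / 2)

theorem evenWord_initSeg (p : ℕ → ℕ) (k : ℕ) :
    evenWord (initSeg p k) = initSeg (evenPart p) (k / 2) := by
  rw [evenWord, length_initSeg, initSeg_eq_iff]
  intro i hi
  exact getD_initSeg (by omega)

theorem oddWord_initSeg (p : ℕ → ℕ) (k : ℕ) :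
    oddWord (initSeg p k) = initSeg (oddPart p) (k / 2) := by
  rw [oddWord, length_initSeg, initSeg_eq_iff]
  intro i hi
  exact getD_initSeg (by omega)

variable {α : Type*} [Primcodable α]

@[fun_prop]
theorem Computable.comp_evenWord {f : α → List ℕ} (hf : Computable f) :
    Computable fun a => evenWord (f a) := by
  unfold evenWord; fun_prop

@[fun_prop]
theorem Computable.comp_oddWord {f : α → List ℕ} (hf : Computable f) :
    Computable fun a => oddWord (f a) := by
  unfold oddWord; fun_prop

/-- A recursively enumerable relation between finite initial segments, questions and answers is
uniformized by a computable functional, defined on all points of Baire space for which each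
question has an answer. -/
theorem REPred.exists_computes {P : (List ℕ × ℕ) × ℕ → Prop} (hP : REPred P) :
    ∃ φ : List ℕ × ℕ → Option ℕ, Computable φ ∧ ∀ p : ℕ → ℕ,
      (∀ n, ∃ k c, P ((initSeg p k, n), c)) →
      ∃ q, Computes φ p q ∧ ∀ n, ∃ k, P ((initSeg p k, n), q n) := by
  classical
  obtain ⟨D, hD, hPD⟩ := hP.exists_computablePred
  -- `z` codes a prefix length, an answer and a number of steps; the functional searches all
  -- `z` below the length of the word it has read.
  let E : List ℕ × ℕ → ℕ → Prop := fun a z => z.unpair.1 ≤ a.1.length ∧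
    D (((a.1.take z.unpair.1, a.2), z.unpair.2.unpair.1), z.unpair.2.unpair.2)
  let step : List ℕ × ℕ → ℕ → Option ℕ → Option ℕ := fun a z o =>
    if E a z then some z.unpair.2.unpair.1 else o
  let search : List ℕ × ℕ → ℕ → Option ℕ := fun a N =>
    Nat.rec (motive := fun _ => Option ℕ) none (step a) N
  have hsome : ∀ a N c, search a N = some c → ∃ z, E a z ∧ c = z.unpair.2.unpair.1 := by
    intro a N c
    induction N with
    | zero => intro h; cases h
    | succ N ih =>
      intro h
      change (if E a N then _ else search a N) = _ at h
      split_ifs at h with hE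
      · exact ⟨N, hE, (Option.some.inj h).symm⟩
      · exact ih h
  have hnone : ∀ a N, search a N = none → ∀ z < N, ¬ E a z := by
    intro a N
    induction N with
    | zero => intro _ z hz; omega
    | succ N ih =>
      intro h z hz
      change (if E a N then _ else search a N) = _ at h
      split_ifs at h with hE
      rcases Nat.lt_succ_iff_lt_or_eq.1 hz with hz | rfl
      · exact ih h z hz
      · exact hE
  refine ⟨fun a => search a a.1.length, ?_, fun p hp => ?_⟩
  · have hE : ComputablePred fun p : (List ℕ × ℕ) × ℕ × Option ℕ => E p.1 p.2.1 := by
      simp only [E]; fun_prop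
    exact Computable.comp_natRec (by fun_prop) (Computable.const _)
      (Computable.comp_ite hE (by fun_prop) (by fun_prop))
  · have hex : ∀ n, ∃ k, search (initSeg p k, n) k ≠ none := by
      intro n
      obtain ⟨k, c, h⟩ := hp n
      obtain ⟨t, ht⟩ := (hPD _).1 h
      let z := Nat.pair k (Nat.pair c t)
      refine ⟨max k (z + 1), fun h => hnone _ _ h z (by omega) ?_⟩
      simp only [E, z, Nat.unpair_pair, length_initSeg, take_initSeg]
      refine ⟨le_max_left _ _, ?_⟩
      rwa [min_eq_left (le_max_left _ _)]
    choose q hq using fun n => Option.ne_none_iff_exists'.1 (Nat.find_spec (hex n))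
    refine ⟨q, fun n => ⟨Nat.find (hex n), ?_, fun j hj => ?_⟩, fun n => ?_⟩
    · simp only [length_initSeg, hq]
    · simpa [length_initSeg] using Nat.find_min (hex n) hj
    · obtain ⟨z, ⟨-, hz⟩, hc⟩ := hsome _ _ _ (hq n)
      rw [take_initSeg] at hz
      exact ⟨_, (hPD _).2 ⟨_, by rw [hc]; exact hz⟩⟩

/-- Two relations between words, one for each half of the output, that are enumerated from an
input `p` are turned by a computable functional into a pair of names of open sets: the search
for an acceptance of a word is bounded by the length of that word, so that each output digit is
decided after finitely many steps. -/
theorem REPred.exists_computes_pair {Q₀ Q₁ : List ℕ × List ℕ → Prop} (h₀ : REPred Q₀)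
    (h₁ : REPred Q₁) :
    ∃ φ : List ℕ × ℕ → Option ℕ, Computable φ ∧ ∀ p : ℕ → ℕ, ∃ q, Computes φ p q ∧
      (∀ r : ℕ → ℕ, (∃ k, evenPart q (Encodable.encode (initSeg r k)) ≠ 0) ↔
        ∃ j k, Q₀ (initSeg p j, initSeg r k)) ∧
      (∀ r : ℕ → ℕ, (∃ k, oddPart q (Encodable.encode (initSeg r k)) ≠ 0) ↔
        ∃ j k, Q₁ (initSeg p j, initSeg r k)) := by
  have hQ : REPred fun a : ℕ × List ℕ × List ℕ => (a.1 = 0 ∧ Q₀ a.2) ∨ (a.1 = 1 ∧ Q₁ a.2) := by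
    fun_prop
  obtain ⟨D, hD, hQD⟩ := hQ.exists_computablePred
  let E : List ℕ → ℕ → Prop := fun u m =>
    ∃ j < (Denumerable.ofNat (List ℕ) (m / 2)).length + 1,
    ∃ k < (Denumerable.ofNat (List ℕ) (m / 2)).length + 1,
    ∃ t < (Denumerable.ofNat (List ℕ) (m / 2)).length + 1,
      D ((m % 2, u.take j, (Denumerable.ofNat (List ℕ) (m / 2)).take k), t)
  have hE : ComputablePred fun a : (List ℕ × ℕ) × ℕ => E a.1.1 a.1.2 := by
    simp only [E]
    fun_prop
  have hP : ComputablePred fun a : (List ℕ × ℕ) × ℕ =>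
      (Denumerable.ofNat (List ℕ) (a.1.2 / 2)).length ≤ a.1.1.length ∧
      ((E a.1.1 a.1.2 ∧ a.2 = 1) ∨ (¬ E a.1.1 a.1.2 ∧ a.2 = 0)) := by
    fun_prop
  obtain ⟨φ, hφ, H⟩ := hP.to_re.exists_computes
  refine ⟨φ, hφ, fun p => ?_⟩
  obtain ⟨q, hq, hq'⟩ := H p fun n => by
    refine ⟨(Denumerable.ofNat (List ℕ) (n / 2)).length, ?_⟩
    by_cases h : E (initSeg p (Denumerable.ofNat (List ℕ) (n / 2)).length) n
    · exact ⟨1, by simp [length_initSeg, h]⟩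
    · exact ⟨0, by simp [length_initSeg, h]⟩
  have key : ∀ (s : ℕ) (r : ℕ → ℕ), s < 2 →
      ((∃ k, q (2 * Encodable.encode (initSeg r k) + s) ≠ 0) ↔
        ∃ j k, (s = 0 ∧ Q₀ (initSeg p j, initSeg r k)) ∨
          (s = 1 ∧ Q₁ (initSeg p j, initSeg r k))) := by
    intro s r hs
    have hdiv : ∀ x, (2 * x + s) / 2 = x := fun x => by omega
    have hmod : ∀ x, (2 * x + s) % 2 = s := fun x => by omega
    have hdig : ∀ k, q (2 * Encodable.encode (initSeg r k) + s) ≠ 0 ↔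
        ∃ j < k + 1, ∃ l < k + 1, ∃ t < k + 1, D ((s, initSeg p j, initSeg r l), t) := by
      intro k
      obtain ⟨K, hK, hd⟩ := hq' (2 * Encodable.encode (initSeg r k) + s)
      simp only [hdiv, Denumerable.ofNat_encode, length_initSeg] at hK
      have hEiff : E (initSeg p K) (2 * Encodable.encode (initSeg r k) + s) ↔
          ∃ j < k + 1, ∃ l < k + 1, ∃ t < k + 1, D ((s, initSeg p j, initSeg r l), t) := by
        simp only [E, hdiv, hmod, Denumerable.ofNat_encode, length_initSeg, take_initSeg]
        refine exists_congr fun j => and_congr_right fun hj => exists_congr fun l =>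
          and_congr_right fun hl => ?_
        rw [min_eq_left (by omega), min_eq_left (by omega)]
      rw [← hEiff]
      rcases hd with ⟨h1, h2⟩ | ⟨h1, h2⟩
      · simp only at h1 h2; simp [h1, h2]
      · simp only at h1 h2; simp [h1, h2]
    simp only [hdig]
    constructor
    · rintro ⟨k, j, -, l, -, t, -, h⟩
      exact ⟨j, l, (hQD _).2 ⟨t, h⟩⟩
    · rintro ⟨j, l, h⟩
      obtain ⟨t, ht⟩ := (hQD (s, initSeg p j, initSeg r l)).1 h
      exact ⟨max j (max l t), j, by omega, l, by omega, t, by omega, ht⟩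
  refine ⟨q, hq, fun r => ?_, fun r => ?_⟩
  · simpa [evenPart] using key 0 r (by norm_num)
  · simpa [oddPart] using key 1 r (by norm_num)

end Functionals

/-! ### Subspaces of computable metric spaces -/

section Metrizability

/-- `c` is the answer of `φ` to the question `n` exactly when the word `u` has been read. -/
def FirstAnswer (φ : List ℕ × ℕ → Option ℕ) (u : List ℕ) (n c : ℕ) : Prop :=
  φ (u, n) = some c ∧ ∀ j < u.length, φ (u.take j, n) = none

theorem firstAnswer_initSeg {φ : List ℕ × ℕ → Option ℕ} {p : ℕ → ℕ} {k n c : ℕ} :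
    FirstAnswer φ (initSeg p k) n c ↔
      φ (initSeg p k, n) = some c ∧ ∀ j < k, φ (initSeg p j, n) = none := by
  rw [FirstAnswer, length_initSeg]
  refine and_congr_right fun _ => forall₂_congr fun j hj => ?_
  rw [take_initSeg, min_eq_left hj.le]

theorem Computes.exists_firstAnswer {φ : List ℕ × ℕ → Option ℕ} {p q : ℕ → ℕ}
    (h : Computes φ p q) (n : ℕ) : ∃ k, FirstAnswer φ (initSeg p k) n (q n) :=
  (h n).imp fun _ => firstAnswer_initSeg.2

theorem Computes.eq_of_firstAnswer {φ : List ℕ × ℕ → Option ℕ} {p q : ℕ → ℕ}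
    (h : Computes φ p q) {k n c : ℕ} (hc : FirstAnswer φ (initSeg p k) n c) : q n = c := by
  obtain ⟨l, hl, hl'⟩ := h n
  obtain ⟨hk, hk'⟩ := firstAnswer_initSeg.1 hc
  rcases lt_trichotomy k l with hkl | rfl | hkl
  · rw [hl' k hkl] at hk; cases hk
  · exact Option.some.inj (hl.symm.trans hk)
  · rw [hk' l hkl] at hl; cases hl

theorem REPred.firstAnswer {α : Type*} [Primcodable α] {φ : List ℕ × ℕ → Option ℕ}
    (hφ : Computable φ) {u : α → List ℕ} {n c : α → ℕ} (hu : Computable u) (hn : Computable n)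
    (hc : Computable c) : REPred fun a => FirstAnswer φ (u a) (n a) (c a) := by
  unfold FirstAnswer
  fun_prop

variable {Y : Type u} [RepresentedSpace Y] {M : Type v} [ComputableMetricSpace M]

/-- The topology that a computable embedding induces is the one of the representation. The
inverse of the embedding is continuous because each point `ι x` has a name that approximates it
twice as well as required, so that the points close to `ι x` have names with the same beginning. -/
theorem ComputableEmbedding.isInducing {ι : Y → M} (h : ComputableEmbedding ι) :
    TopologicalSpace.induced ι inferInstance = repTopology Y := by
  obtain ⟨-, ⟨φ, -, hφ⟩, ⟨ψ, -, hψ⟩⟩ := h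
  ext U
  rw [isOpen_repTopology_iff]
  constructor
  · rintro ⟨V, hV, rfl⟩ p x hp hx
    obtain ⟨ε, hε, hball⟩ := Metric.isOpen_iff.1 hV (ι x) hx
    obtain ⟨n, hn⟩ := exists_pow_lt_of_lt_one (half_pos hε) (show (1 / 2 : ℝ) < 1 by norm_num)
    obtain ⟨q, hq, hqx⟩ := hφ p x hp
    obtain ⟨k, hk⟩ := hq.exists_firstAnswer n
    refine ⟨k, fun r y hr hy => hball ?_⟩
    obtain ⟨s, hs, hsy⟩ := hφ r y hy
    have hqs : s n = q n := hs.eq_of_firstAnswer (k := k) (by rwa [hr])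
    have h1 := hqx n
    have h2 := hsy n
    rw [hqs] at h2
    rw [Metric.mem_ball]
    have := dist_triangle_left (ι y) (ι x) (ComputableMetricSpace.pts (q n))
    linarith
  · intro hU
    let : TopologicalSpace Y := TopologicalSpace.induced ι inferInstance
    refine isOpen_iff_mem_nhds.2 fun x hx => ?_
    rw [nhds_induced, Filter.mem_comap]
    have hq : ∀ n : ℕ, ∃ i, dist (ComputableMetricSpace.pts i) (ι x) ≤ (1 / 2) ^ (n + 1) := by
      intro n
      obtain ⟨i, hi⟩ := ComputableMetricSpace.denseRange_pts.exists_dist_lt (ι x)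
        (show (0 : ℝ) < (1 / 2) ^ (n + 1) by positivity)
      exact ⟨i, by rw [dist_comm]; exact hi.le⟩
    choose q hq using hq
    have hqx : IsName q (ι x) := fun n => (hq n).trans
      (pow_le_pow_of_le_one (by norm_num) (by norm_num) (Nat.le_succ n))
    obtain ⟨p, hp, hpx⟩ := hψ q x hqx
    obtain ⟨k, hk⟩ := hU p x hpx hx
    choose l hl using hp.exists_firstAnswer
    let K := (Finset.range k).sup l
    have hK : ∀ n < k, l n ≤ K := fun n hn => Finset.le_sup (f := l) (Finset.mem_range.2 hn)
    refine ⟨Metric.ball (ι x) ((1 / 2) ^ (K + 1)), Metric.ball_mem_nhds _ (by positivity), ?_⟩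
    intro y hy
    obtain ⟨r, hr⟩ := exists_isName (ι y)
    let s : ℕ → ℕ := fun n => if n < K then q n else r n
    have hs : IsName s (ι y) := by
      intro n
      by_cases hn : n < K
      · simp only [s, if_pos hn]
        have h1 := hq n
        have h2 : dist (ι y) (ι x) < (1 / 2) ^ (K + 1) := hy
        have h3 : (1 / 2 : ℝ) ^ (K + 1) ≤ (1 / 2) ^ (n + 1) :=
          pow_le_pow_of_le_one (by norm_num) (by norm_num) (by omega)
        have h4 := dist_triangle_right (ComputableMetricSpace.pts (q n)) (ι y) (ι x)
        have h5 : (1 / 2 : ℝ) ^ n = (1 / 2) ^ (n + 1) + (1 / 2) ^ (n + 1) := by ring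
        linarith
      · simp only [s, if_neg hn]
        exact hr n
    obtain ⟨t, ht, hty⟩ := hψ s y hs
    refine hk t y (initSeg_eq_iff.2 fun n hn => ?_) hty
    refine ht.eq_of_firstAnswer (k := l n) ?_
    have : initSeg s (l n) = initSeg q (l n) := initSeg_eq_iff.2 fun i hi => by
      simp only [s, if_pos (hi.trans_le (hK n hn))]
    rw [this]
    exact hl n

/-- The distance of the images under a computable map into a computable metric space is
computable. -/
theorem ComputableMap.dist {ι : Y → M} (h : ComputableMap ι) :
    ComputableMap fun z : Y × Y => dist (ι z.1) (ι z.2) := by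
  obtain ⟨φ, hφ, hφι⟩ := h
  obtain ⟨f, hf, hfd⟩ := ComputableMetricSpace.computable_dist (M := M)
  have hP : REPred fun a : (List ℕ × ℕ) × ℕ => ∃ k l i j,
      FirstAnswer φ ((evenWord a.1.1).take k) (a.1.2 + 2) i ∧
      FirstAnswer φ ((oddWord a.1.1).take l) (a.1.2 + 2) j ∧ a.2 = f (i, j, a.1.2 + 1) := by
    refine REPred.comp_exists (REPred.comp_exists (REPred.comp_exists (REPred.comp_exists
      (REPred.comp_and (REPred.firstAnswer hφ ?_ ?_ ?_)
        (REPred.comp_and (REPred.firstAnswer hφ ?_ ?_ ?_) ?_))))) <;> fun_prop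
  obtain ⟨ψ, hψ, H⟩ := hP.exists_computes
  refine ⟨ψ, hψ, fun p z hp => ?_⟩
  obtain ⟨q, hq, hqz⟩ := hφι _ _ hp.1
  obtain ⟨r, hr, hrz⟩ := hφι _ _ hp.2
  obtain ⟨s, hs, hs'⟩ := H p fun n => by
    obtain ⟨k, hk⟩ := hq.exists_firstAnswer (n + 2)
    obtain ⟨l, hl⟩ := hr.exists_firstAnswer (n + 2)
    refine ⟨2 * max k l, f (q (n + 2), r (n + 2), n + 1), k, l, _, _, ?_, ?_, rfl⟩
    · rw [evenWord_initSeg, take_initSeg, min_eq_left (by omega)]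
      exact hk
    · rw [oddWord_initSeg, take_initSeg, min_eq_left (by omega)]
      exact hl
  refine ⟨s, hs, fun n => ?_⟩
  obtain ⟨K, k, l, i, j, hi, hj, hc⟩ := hs' n
  simp only at hi hj hc
  rw [evenWord_initSeg, take_initSeg] at hi
  rw [oddWord_initSeg, take_initSeg] at hj
  have h1 := hqz (n + 2)
  have h2 := hrz (n + 2)
  rw [hq.eq_of_firstAnswer hi] at h1
  rw [hr.eq_of_firstAnswer hj] at h2
  have h3 := hfd i j (n + 1)
  have h4 := abs_sub_le (ratOfCode (s n) : ℝ)
    (Dist.dist (ComputableMetricSpace.pts i : M) (ComputableMetricSpace.pts j))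
    (Dist.dist (ι z.1) (ι z.2))
  have h5 : |Dist.dist (ComputableMetricSpace.pts i : M) (ComputableMetricSpace.pts j) -
      Dist.dist (ι z.1) (ι z.2)| ≤ _ := dist_dist_dist_le _ _ _ _
  have h6 : (1 / 2 : ℝ) ^ n = (1 / 2) ^ (n + 2) + (1 / 2) ^ (n + 2) + (1 / 2) ^ (n + 1) := by ring
  rw [← hc] at h3
  change |(ratOfCode (s n) : ℝ) - Dist.dist (ι z.1) (ι z.2)| ≤ (1 / 2) ^ n
  linarith

/-- A represented space that embeds computably into a computable metric space is computably
metrizable, by the metric induced from the embedding. -/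
theorem ComputableEmbedding.computablyMetrizable {M : Type} [ComputableMetricSpace M]
    {ι : Y → M} (h : ComputableEmbedding ι) : ComputablyMetrizable Y :=
  ⟨MetricSpace.induced ι h.1 inferInstance, h.isInducing, h.2.1.dist, M, inferInstance, ι,
    fun _ _ => rfl, h⟩

end Metrizability

/-! ### The Hilbert cube as a computable metric space -/

section HilbertCube

open Computable

/-- The Hilbert cube `∏ i, [0, 2⁻ⁱ]` with the supremum metric. -/
def HilbertCube : Type :=
  {x : BoundedContinuousFunction ℕ ℝ // ∀ i, x i ∈ Icc (0 : ℝ) ((1 / 2) ^ i)}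

namespace HilbertCube

noncomputable instance : MetricSpace HilbertCube :=
  inferInstanceAs (MetricSpace {_x : BoundedContinuousFunction ℕ ℝ // _})

/-- The `i`-th coordinate of a point of the Hilbert cube. -/
def coord (x : HilbertCube) (i : ℕ) : ℝ := x.1 i

theorem coord_mem (x : HilbertCube) (i : ℕ) : x.coord i ∈ Icc (0 : ℝ) ((1 / 2) ^ i) := x.2 i

/-- The point of the Hilbert cube with given coordinates. -/
noncomputable def ofCoord (x : ℕ → ℝ) (hx : ∀ i, x i ∈ Icc (0 : ℝ) ((1 / 2) ^ i)) :
    HilbertCube :=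
  ⟨BoundedContinuousFunction.ofNormedAddCommGroupDiscrete x 1 fun i => by
    rw [Real.norm_eq_abs, abs_of_nonneg (hx i).1]
    exact (hx i).2.trans (pow_le_one₀ (by norm_num) (by norm_num)), hx⟩

theorem dist_le {x y : HilbertCube} {C : ℝ} (hC : 0 ≤ C) :
    dist x y ≤ C ↔ ∀ i, |x.coord i - y.coord i| ≤ C :=
  BoundedContinuousFunction.dist_le hC

/-- The number of digits of a grid point. A grid point is coded by a list of numerators, whose
length is the number of possibly nonzero coordinates and also determines the denominators. -/
def gridLen (c : ℕ) : ℕ := (Denumerable.ofNat (List ℕ) c).length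

/-- The `i`-th numerator of a grid point. -/
def gridNum (c i : ℕ) : ℕ := min ((Denumerable.ofNat (List ℕ) c).getD i 0) (2 ^ gridLen c)

theorem gridNum_of_le {c i : ℕ} (h : gridLen c ≤ i) : gridNum c i = 0 := by
  rw [gridNum, List.getD_eq_default _ _ h, Nat.zero_min]

variable {α : Type*} [Primcodable α]

@[fun_prop]
theorem comp_gridLen {f : α → ℕ} (hf : Computable f) : Computable fun a => gridLen (f a) := by
  unfold gridLen; fun_prop

@[fun_prop]
theorem comp_gridNum {f g : α → ℕ} (hf : Computable f) (hg : Computable g) :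
    Computable fun a => gridNum (f a) (g a) := by
  unfold gridNum; fun_prop

/-- The grid points of the Hilbert cube. -/
noncomputable def gridPt (c : ℕ) : HilbertCube :=
  ofCoord (fun i => gridNum c i / 2 ^ (gridLen c + i)) fun i => by
    have h : (gridNum c i : ℝ) ≤ 2 ^ gridLen c := by
      exact_mod_cast min_le_right _ _
    refine ⟨by positivity, ?_⟩
    rw [div_le_iff₀ (by positivity), pow_add, one_div, inv_pow]
    have h2 : ((2 : ℝ) ^ i)⁻¹ * (2 ^ gridLen c * 2 ^ i) = 2 ^ gridLen c := by
      field_simp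
    rwa [h2]

theorem coord_gridPt (c i : ℕ) : (gridPt c).coord i = gridNum c i / 2 ^ (gridLen c + i) := rfl

/-- The distance of two grid points, multiplied by `2 ^ (2 * (gridLen c + gridLen d))`. -/
def gridDist (c d : ℕ) : ℕ :=
  (Finset.range (gridLen c + gridLen d)).sup fun i =>
    ((gridNum c i * 2 ^ gridLen d - gridNum d i * 2 ^ gridLen c) +
      (gridNum d i * 2 ^ gridLen c - gridNum c i * 2 ^ gridLen d)) *
        2 ^ (gridLen c + gridLen d - i)

@[fun_prop]
theorem comp_gridDist {f g : α → ℕ} (hf : Computable f) (hg : Computable g) :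
    Computable fun a => gridDist (f a) (g a) := by
  unfold gridDist
  exact comp_sup (by fun_prop) (by fun_prop)

theorem cast_sub_add_sub (a b : ℕ) : (((a - b) + (b - a) : ℕ) : ℝ) = |(a : ℝ) - b| := by
  rcases le_total a b with h | h
  · rw [Nat.sub_eq_zero_of_le h, zero_add, Nat.cast_sub h, abs_sub_comm,
      abs_of_nonneg (sub_nonneg.2 (Nat.cast_le.2 h))]
  · rw [Nat.sub_eq_zero_of_le h, add_zero, Nat.cast_sub h,
      abs_of_nonneg (sub_nonneg.2 (Nat.cast_le.2 h))]

theorem abs_coord_gridPt_sub {c d i : ℕ} (hi : i ≤ gridLen c + gridLen d) :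
    |(gridPt c).coord i - (gridPt d).coord i| =
      (((gridNum c i * 2 ^ gridLen d - gridNum d i * 2 ^ gridLen c) +
      (gridNum d i * 2 ^ gridLen c - gridNum c i * 2 ^ gridLen d)) *
        2 ^ (gridLen c + gridLen d - i) : ℕ) / 2 ^ (2 * (gridLen c + gridLen d)) := by
  rw [Nat.cast_mul, cast_sub_add_sub, coord_gridPt, coord_gridPt]
  push_cast
  obtain ⟨e, he⟩ := Nat.exists_eq_add_of_le hi
  have h1 : gridLen c + gridLen d - i = e := by omega
  have h2 : (2 : ℝ) ^ (2 * (gridLen c + gridLen d)) =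
      2 ^ e * (2 ^ gridLen c * 2 ^ gridLen d * 2 ^ i) := by
    rw [← pow_add, ← pow_add, ← pow_add]
    congr 1
    omega
  rw [h1, h2, mul_comm, mul_div_mul_left _ _ (by positivity),
    ← abs_of_pos (show (0 : ℝ) < 2 ^ gridLen c * 2 ^ gridLen d * 2 ^ i by positivity), ← abs_div]
  congr 1
  field_simp
  ring

theorem dist_gridPt (c d : ℕ) :
    dist (gridPt c) (gridPt d) = gridDist c d / 2 ^ (2 * (gridLen c + gridLen d)) := by
  refine le_antisymm ((dist_le (by positivity)).2 fun i => ?_) ?_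
  · rcases lt_or_ge i (gridLen c + gridLen d) with hi | hi
    · rw [abs_coord_gridPt_sub hi.le]
      gcongr
      exact Finset.le_sup (f := fun i =>
        ((gridNum c i * 2 ^ gridLen d - gridNum d i * 2 ^ gridLen c) +
          (gridNum d i * 2 ^ gridLen c - gridNum c i * 2 ^ gridLen d)) *
            2 ^ (gridLen c + gridLen d - i)) (Finset.mem_range.2 hi)
    · rw [coord_gridPt, coord_gridPt, gridNum_of_le (by omega), gridNum_of_le (by omega)]
      simp only [Nat.cast_zero, zero_div, sub_zero, abs_zero]
      positivity
  · have h := (dist_le (x := gridPt c) (y := gridPt d) dist_nonneg).1 le_rfl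
    rw [div_le_iff₀ (by positivity)]
    have hD : gridDist c d ≤ ⌊dist (gridPt c) (gridPt d) * 2 ^ (2 * (gridLen c + gridLen d))⌋₊ := by
      refine Finset.sup_le fun i hi => Nat.le_floor ?_
      rw [← div_le_iff₀ (by positivity), ← abs_coord_gridPt_sub (Finset.mem_range.1 hi).le]
      exact h i
    exact (Nat.cast_le.2 hD).trans (Nat.floor_le (by positivity))

/-- A point of the Hilbert cube is approximated by every grid point with sufficiently many
numerators that are close to its first coordinates. -/
theorem dist_gridPt_le {x : HilbertCube} {c n : ℕ} (hc : gridLen c = n + 1)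
    (h : ∀ i < n + 1, |(gridNum c i : ℝ) / 2 ^ (n + 1) - 2 ^ i * x.coord i| ≤ (1 / 2) ^ n) :
    dist (gridPt c) x ≤ (1 / 2) ^ n := by
  refine (dist_le (by positivity)).2 fun i => ?_
  rcases lt_or_ge i (n + 1) with hi | hi
  · have h1 : (gridPt c).coord i - x.coord i =
        ((gridNum c i : ℝ) / 2 ^ (n + 1) - 2 ^ i * x.coord i) / 2 ^ i := by
      rw [coord_gridPt, hc, pow_add]
      field_simp
    rw [h1, abs_div, abs_of_pos (show (0 : ℝ) < 2 ^ i by positivity)]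
    exact (div_le_self (abs_nonneg _) (one_le_pow₀ (by norm_num))).trans (h i hi)
  · rw [coord_gridPt, gridNum_of_le (hc.trans_le hi), Nat.cast_zero, zero_div, zero_sub, abs_neg,
      abs_of_nonneg (x.coord_mem i).1]
    exact (x.coord_mem i).2.trans (pow_le_pow_of_le_one (by norm_num) (by norm_num) (by omega))

theorem denseRange_gridPt : DenseRange gridPt := by
  intro x
  rw [Metric.mem_closure_range_iff]
  intro ε hε
  obtain ⟨n, hn⟩ := exists_pow_lt_of_lt_one hε (show (1 / 2 : ℝ) < 1 by norm_num)
  let L : List ℕ := initSeg (fun i => ⌊2 ^ (n + 1) * (2 ^ i * x.coord i)⌋₊) (n + 1)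
  have hlen : gridLen (Encodable.encode L) = n + 1 := by
    rw [gridLen, Denumerable.ofNat_encode, length_initSeg]
  refine ⟨Encodable.encode L, ?_⟩
  rw [dist_comm]
  refine (dist_gridPt_le hlen fun i hi => ?_).trans_lt hn
  have h0 : 0 ≤ 2 ^ i * x.coord i := mul_nonneg (by positivity) (x.coord_mem i).1
  have h1 : 2 ^ i * x.coord i ≤ 1 := by
    have := mul_le_mul_of_nonneg_left (x.coord_mem i).2 (show (0 : ℝ) ≤ 2 ^ i by positivity)
    rwa [← mul_pow, mul_one_div_cancel (two_ne_zero), one_pow] at this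
  have hnum : gridNum (Encodable.encode L) i = ⌊2 ^ (n + 1) * (2 ^ i * x.coord i)⌋₊ := by
    rw [gridNum, hlen, Denumerable.ofNat_encode, getD_initSeg hi, min_eq_left]
    refine Nat.floor_le_of_le ?_
    push_cast
    exact mul_le_of_le_one_right (by positivity) h1
  rw [hnum, abs_sub_comm]
  have hp : (0 : ℝ) < 2 ^ (n + 1) := by positivity
  have h2 := Nat.floor_le (mul_nonneg hp.le h0)
  have h3 := Nat.lt_floor_add_one ((2 : ℝ) ^ (n + 1) * (2 ^ i * x.coord i))
  have h4 : (1 / 2 : ℝ) ^ (n + 1) ≤ (1 / 2) ^ n :=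
    pow_le_pow_of_le_one (by norm_num) (by norm_num) (Nat.le_succ n)
  refine le_trans ?_ h4
  rw [abs_of_nonneg, sub_le_iff_le_add, one_div, inv_pow, inv_eq_one_div, ← add_div,
    le_div_iff₀ hp]
  · linarith
  · rw [sub_nonneg, div_le_iff₀ hp]
    linarith

noncomputable instance : ComputableMetricSpace HilbertCube where
  pts := gridPt
  denseRange_pts := denseRange_gridPt
  computable_dist := by
    refine ⟨fun a => Nat.pair (Nat.pair (gridDist a.1 a.2.1) 0)
      (2 ^ (2 * (gridLen a.1 + gridLen a.2.1)) - 1), by fun_prop, fun i j n => ?_⟩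
    have h : ((2 ^ (2 * (gridLen i + gridLen j)) - 1 : ℕ) : ℝ) + 1 =
        2 ^ (2 * (gridLen i + gridLen j)) := by
      rw [Nat.cast_sub Nat.one_le_two_pow]
      push_cast
      ring
    simp only [ratOfCode, Nat.unpair_pair]
    rw [dist_gridPt]
    push_cast at h ⊢
    rw [h]
    simp

theorem isName_iff {p : ℕ → ℕ} {x : HilbertCube} :
    IsName p x ↔ ∀ n, dist (gridPt (p n)) x ≤ (1 / 2) ^ n := Iff.rfl

end HilbertCube

end HilbertCube

/-! ### The way-below relation of an effective relatively compact system -/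

section WayBelow

variable {X : Type u} [RepresentedSpace X]

/-- The union of a set of members of a sequence of open sets. -/
def OpenSet.biUnion (U : ℕ → OpenSet X) (T : Set ℕ) : OpenSet X :=
  ⟨⋃ m ∈ T, (U m).carrier, by
    let := repTopology X
    exact isOpen_biUnion fun m _ => (U m).isOpen'⟩

theorem OpenSet.mem_biUnion {U : ℕ → OpenSet X} {T : Set ℕ} {x : X} :
    x ∈ (OpenSet.biUnion U T).carrier ↔ ∃ m ∈ T, x ∈ (U m).carrier := by
  simp [OpenSet.biUnion]

theorem OpenSet.mem_iff_of_isName {U : OpenSet X} {p : ℕ → ℕ} (hp : IsName p U) {q : ℕ → ℕ}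
    {x : X} (hq : IsName q x) :
    x ∈ U.carrier ↔ ∃ k, p (Encodable.encode (initSeg q k)) ≠ 0 :=
  hp q x hq

theorem CompactSet.subset_iff_of_isName {K : CompactSet X} {p : ℕ → ℕ} (hp : IsName p K)
    {V : OpenSet X} {v : ℕ → ℕ} (hv : IsName v V) :
    K.carrier ⊆ V.carrier ↔ ∃ k, p (Encodable.encode (initSeg v k)) ≠ 0 :=
  hp v V hv

/-- Compactness: the neighbourhood filter is open, and a name of a union can be chosen such that
each of its beginnings is the beginning of a name of a finite subunion. -/
theorem CompactSet.exists_finite_subcover (K : CompactSet X) (U : ℕ → OpenSet X) (T : Set ℕ)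
    (h : K.carrier ⊆ (OpenSet.biUnion U T).carrier) :
    ∃ F : List ℕ, (∀ m ∈ F, m ∈ T) ∧ K.carrier ⊆ (OpenSet.biUnion U {m | m ∈ F}).carrier := by
  classical
  choose f hf using fun m => exists_isName (U m)
  -- a word is accepted on behalf of the `m`-th set only if its length is at least `m`
  let r : Set ℕ → ℕ → ℕ := fun T c => if ∃ m ∈ T, m ≤ (Denumerable.ofNat (List ℕ) c).length ∧
    ∃ k, f m (Encodable.encode ((Denumerable.ofNat (List ℕ) c).take k)) ≠ 0 then 1 else 0
  have hr : ∀ T, IsName (r T) (OpenSet.biUnion U T) := by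
    intro T q x hq
    rw [OpenSet.mem_biUnion]
    have hr' : ∀ k, r T (Encodable.encode (initSeg q k)) ≠ 0 ↔
        ∃ m ∈ T, m ≤ k ∧ ∃ l, f m (Encodable.encode (initSeg q (min l k))) ≠ 0 := by
      intro k
      simp only [r, Denumerable.ofNat_encode, length_initSeg, take_initSeg]
      split_ifs with h <;> simp [h]
    simp only [hr']
    constructor
    · rintro ⟨m, hm, hx⟩
      obtain ⟨k, hk⟩ := (OpenSet.mem_iff_of_isName (hf m) hq).1 hx
      exact ⟨max m k, m, hm, le_max_left _ _, k, by rwa [min_eq_left (le_max_right _ _)]⟩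
    · rintro ⟨k, m, hm, -, l, hl⟩
      exact ⟨m, hm, (OpenSet.mem_iff_of_isName (hf m) hq).2 ⟨_, hl⟩⟩
  obtain ⟨k, hk⟩ := isOpen_repTopology_iff.1 K.isOpen_supersets (r T) _ (hr T) h
  let N := (Finset.range k).sup fun c => (Denumerable.ofNat (List ℕ) c).length
  refine ⟨(List.range (N + 1)).filter fun m => m ∈ T, fun m hm => ?_, ?_⟩
  · simpa using (List.mem_filter.1 hm).2
  · refine hk _ _ (initSeg_eq_iff.2 fun c hc => ?_) (hr _)
    have hN : (Denumerable.ofNat (List ℕ) c).length ≤ N :=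
      Finset.le_sup (f := fun c => (Denumerable.ofNat (List ℕ) c).length) (Finset.mem_range.2 hc)
    simp only [r]
    refine if_congr (exists_congr fun m => ?_) rfl rfl
    simp only [mem_ofPred_eq, List.mem_filter, List.mem_range, decide_eq_true_eq]
    constructor
    · rintro ⟨⟨-, h1⟩, h2⟩
      exact ⟨h1, h2⟩
    · rintro ⟨h1, h2, h3⟩
      exact ⟨⟨by omega, h1⟩, h2, h3⟩

namespace ERCS

variable (S : ERCS X)

/-- A uniformly computable sequence of names of the open sets of the system. -/
noncomputable def nameU : ℕ → ℕ → ℕ := S.computable_U.choose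

/-- A uniformly computable sequence of names of the compact sets of the system. -/
noncomputable def nameB : ℕ → ℕ → ℕ := S.computable_B.choose

theorem isName_nameU (m : ℕ) : IsName (S.nameU m) (S.U m) := S.computable_U.choose_spec.2 m

theorem isName_nameB (n : ℕ) : IsName (S.nameB n) (S.B n) := S.computable_B.choose_spec.2 n

/-- The union of a finite list of open sets of the system. -/
def union (F : List ℕ) : OpenSet X := OpenSet.biUnion S.U {m | m ∈ F}

theorem mem_union {F : List ℕ} {x : X} : x ∈ (S.union F).carrier ↔ ∃ m ∈ F, x ∈ (S.U m).carrier :=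
  OpenSet.mem_biUnion

/-- A name of `S.union F`. -/
noncomputable def nameUnion (F : List ℕ) (c : ℕ) : ℕ :=
  ∑ i ∈ Finset.range F.length, S.nameU (F.getD i 0) c

theorem _root_.List.exists_mem_iff_getD {F : List ℕ} {P : ℕ → Prop} :
    (∃ m ∈ F, P m) ↔ ∃ i < F.length, P (F.getD i 0) := by
  rw [List.exists_mem_iff_getElem]
  refine exists_congr fun i => ⟨?_, ?_⟩
  · rintro ⟨h, hP⟩
    exact ⟨h, by rwa [List.getD_eq_getElem _ _ h]⟩
  · rintro ⟨h, hP⟩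
    exact ⟨h, by rwa [List.getD_eq_getElem _ _ h] at hP⟩

theorem isName_nameUnion (F : List ℕ) : IsName (S.nameUnion F) (S.union F) := by
  intro q x hq
  rw [S.mem_union, List.exists_mem_iff_getD]
  simp only [OpenSet.mem_iff_of_isName (S.isName_nameU _) hq, nameUnion, ne_eq,
    Finset.sum_eq_zero_iff, Finset.mem_range, not_forall, exists_prop]
  exact ⟨fun ⟨i, hi, k, hk⟩ => ⟨k, i, hi, hk⟩, fun ⟨k, i, hi, hk⟩ => ⟨i, hi, k, hk⟩⟩

/-- `F` is way below `V` if each of the open sets in the list `F` is formally contained, by the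
relation of the system, in a compact set of the system that is a subset of `V`. -/
def WayBelow (F : List ℕ) (V : OpenSet X) : Prop :=
  ∀ m ∈ F, ∃ n, S.R (m, n) ∧ (S.B n).carrier ⊆ V.carrier

variable {S}

theorem WayBelow.subset {F : List ℕ} {V : OpenSet X} (h : S.WayBelow F V) :
    (S.union F).carrier ⊆ V.carrier := by
  intro x hx
  obtain ⟨m, hm, hx⟩ := S.mem_union.1 hx
  obtain ⟨n, hn, hV⟩ := h m hm
  exact hV (S.subset_of_R m n hn hx)

theorem exists_wayBelow_singleton {V : OpenSet X} {x : X} (hx : x ∈ V.carrier) :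
    ∃ m, S.WayBelow [m] V ∧ x ∈ (S.U m).carrier := by
  rw [S.eq_iUnion V] at hx
  simp only [mem_iUnion, mem_ofPred_eq, exists_prop] at hx
  obtain ⟨n, hn, m, hm, hx⟩ := hx
  exact ⟨m, fun m' hm' => ⟨n, by rwa [List.mem_singleton.1 hm'], hn⟩, hx⟩

/-- Interpolation: by compactness, finitely many of the open sets way below `V` suffice. -/
theorem WayBelow.interpolate {F : List ℕ} {V : OpenSet X} (h : S.WayBelow F V) :
    ∃ G, S.WayBelow F (S.union G) ∧ S.WayBelow G V := by
  induction F with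
  | nil => exact ⟨[], by simp [WayBelow], by simp [WayBelow]⟩
  | cons m F ih =>
    obtain ⟨G, hFG, hGV⟩ := ih fun m' hm' => h m' (List.mem_cons_of_mem _ hm')
    obtain ⟨n, hn, hnV⟩ := h m List.mem_cons_self
    obtain ⟨H, hHV, hnH⟩ := (S.B n).exists_finite_subcover S.U {k | S.WayBelow [k] V}
      fun x hx => by
        obtain ⟨k, hk, hxk⟩ := exists_wayBelow_singleton (S := S) (hnV hx)
        exact OpenSet.mem_biUnion.2 ⟨k, hk, hxk⟩
    have hH : (S.union H).carrier ⊆ (S.union (H ++ G)).carrier := fun x hx => by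
      obtain ⟨k, hk, hx⟩ := S.mem_union.1 hx
      exact S.mem_union.2 ⟨k, List.mem_append_left _ hk, hx⟩
    have hG : (S.union G).carrier ⊆ (S.union (H ++ G)).carrier := fun x hx => by
      obtain ⟨k, hk, hx⟩ := S.mem_union.1 hx
      exact S.mem_union.2 ⟨k, List.mem_append_right _ hk, hx⟩
    refine ⟨H ++ G, fun m' hm' => ?_, fun k hk => ?_⟩
    · rcases List.mem_cons.1 hm' with rfl | hm'
      · exact ⟨n, hn, Subset.trans hnH hH⟩
      · obtain ⟨n', hn', hsub⟩ := hFG m' hm'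
        exact ⟨n', hn', hsub.trans hG⟩
    · rcases List.mem_append.1 hk with hk | hk
      · exact hHV k hk k (List.mem_singleton_self k)
      · exact hGV k hk

variable (S)

/-- The word `w`, read as the beginning of a name of an open set, suffices for a proof that `F`
is way below that open set. -/
def WayBelowWord (F w : List ℕ) : Prop :=
  ∀ i < F.length, ∃ n, S.R (F.getD i 0, n) ∧
    ∃ k < w.length + 1, S.nameB n (Encodable.encode (w.take k)) ≠ 0

variable {S}

theorem wayBelowWord_mono {F : List ℕ} {v : ℕ → ℕ} {j k : ℕ} (hjk : j ≤ k)
    (h : S.WayBelowWord F (initSeg v j)) : S.WayBelowWord F (initSeg v k) := by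
  intro i hi
  obtain ⟨n, hn, l, hl, h⟩ := h i hi
  rw [length_initSeg] at hl
  refine ⟨n, hn, l, by rw [length_initSeg]; omega, ?_⟩
  rw [take_initSeg, min_eq_left (by omega)] at h ⊢
  exact h

theorem wayBelow_iff {F : List ℕ} {V : OpenSet X} {v : ℕ → ℕ} (hv : IsName v V) :
    S.WayBelow F V ↔ ∃ k, S.WayBelowWord F (initSeg v k) := by
  constructor
  · intro h
    have h' : ∀ i < F.length, ∃ n, S.R (F.getD i 0, n) ∧
        ∃ k, S.nameB n (Encodable.encode (initSeg v k)) ≠ 0 := by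
      intro i hi
      obtain ⟨n, hn, hV⟩ := h (F.getD i 0) (by rw [List.getD_eq_getElem _ _ hi]; simp)
      exact ⟨n, hn, (CompactSet.subset_iff_of_isName (S.isName_nameB n) hv).1 hV⟩
    choose! n hn k hk using h'
    let K := (Finset.range F.length).sup k
    refine ⟨K, fun i hi => ⟨n i, hn i hi, k i, ?_, ?_⟩⟩
    all_goals
      have hK : k i ≤ K := Finset.le_sup (f := k) (Finset.mem_range.2 hi)
    · rw [length_initSeg]; omega
    · rw [take_initSeg, min_eq_left hK]; exact hk i hi
  · rintro ⟨K, hK⟩ m hm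
    obtain ⟨i, hi, rfl⟩ := List.exists_mem_iff_getD.1 ⟨m, hm, rfl⟩
    obtain ⟨n, hn, k, -, hk⟩ := hK i hi
    rw [take_initSeg] at hk
    exact ⟨n, hn, (CompactSet.subset_iff_of_isName (S.isName_nameB n) hv).2 ⟨_, hk⟩⟩

variable {α : Type*} [Primcodable α]

@[fun_prop]
theorem comp_nameU {f g : α → ℕ} (hf : Computable f) (hg : Computable g) :
    Computable fun a => S.nameU (f a) (g a) :=
  Computable₂.comp S.computable_U.choose_spec.1 hf hg

@[fun_prop]
theorem comp_nameB {f g : α → ℕ} (hf : Computable f) (hg : Computable g) :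
    Computable fun a => S.nameB (f a) (g a) :=
  Computable₂.comp S.computable_B.choose_spec.1 hf hg

@[fun_prop]
theorem comp_nameUnion {f : α → List ℕ} {g : α → ℕ} (hf : Computable f) (hg : Computable g) :
    Computable fun a => S.nameUnion (f a) (g a) := by
  unfold nameUnion
  exact Computable.comp_sum (by fun_prop) (by fun_prop)

@[fun_prop]
theorem comp_wayBelowWord {f g : α → List ℕ} (hf : Computable f) (hg : Computable g) :
    REPred fun a => S.WayBelowWord (f a) (g a) := by
  have hR := S.re_R
  unfold WayBelowWord
  fun_prop

end ERCS

end WayBelow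

/-! ### Urysohn functions on the hyperspace -/

section Urysohn

variable {X : Type u} [RepresentedSpace X]

namespace ERCS

/-- A computable enumeration of all pairs `lo a ≪ hi a` of finite lists, together with a
computable interpolation: the pair `a` is split into the two pairs `left a` and `right a`. -/
structure InterpolationSystem (S : ERCS X) where
  lo : ℕ → List ℕ
  hi : ℕ → List ℕ
  left : ℕ → ℕ
  right : ℕ → ℕ
  computable_lo : Computable lo
  computable_hi : Computable hi
  computable_left : Computable left
  computable_right : Computable right
  wayBelow : ∀ a, S.WayBelow (lo a) (S.union (hi a))
  exists_eq : ∀ F G, S.WayBelow F (S.union G) → ∃ a, lo a = F ∧ hi a = G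
  lo_left : ∀ a, lo (left a) = lo a
  hi_left : ∀ a, hi (left a) = lo (right a)
  hi_right : ∀ a, hi (right a) = hi a

theorem nonempty_interpolationSystem (S : ERCS X) : Nonempty S.InterpolationSystem := by
  classical
  have hW : REPred fun p : List ℕ × List ℕ =>
      ∃ k, S.WayBelowWord p.1 (initSeg (S.nameUnion p.2) k) := by
    fun_prop
  obtain ⟨D, hD, hWD⟩ := hW.exists_computablePred
  have hD' : ∀ F G, S.WayBelow F (S.union G) ↔ ∃ t, D ((F, G), t) := fun F G =>
    (wayBelow_iff (S.isName_nameUnion G)).trans (hWD (F, G))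
  let e : ℕ → (List ℕ × List ℕ) × ℕ := fun a => Denumerable.ofNat _ a
  let lo : ℕ → List ℕ := fun a => if D (e a) then (e a).1.1 else []
  let hi : ℕ → List ℕ := fun a => if D (e a) then (e a).1.2 else []
  have hlo : Computable lo := by simp only [lo, e]; fun_prop
  have hhi : Computable hi := by simp only [hi, e]; fun_prop
  have hwb : ∀ a, S.WayBelow (lo a) (S.union (hi a)) := by
    intro a
    by_cases h : D (e a)
    · simp only [lo, hi, if_pos h]
      exact (hD' _ _).2 ⟨_, h⟩
    · simp [lo, h, WayBelow]
  have hex : ∀ F G, S.WayBelow F (S.union G) → ∃ a, lo a = F ∧ hi a = G := by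
    intro F G h
    obtain ⟨t, ht⟩ := (hD' F G).1 h
    refine ⟨Encodable.encode ((F, G), t), ?_⟩
    simp [lo, hi, e, Denumerable.ofNat_encode, ht]
  have hsplit : ∀ a, ∃ n : ℕ, lo n.unpair.1 = lo a ∧ hi n.unpair.1 = lo n.unpair.2 ∧
      hi n.unpair.2 = hi a := by
    intro a
    obtain ⟨G, h1, h2⟩ := (hwb a).interpolate
    obtain ⟨b, hb, hb'⟩ := hex _ _ h1
    obtain ⟨c, hc, hc'⟩ := hex _ _ h2
    refine ⟨Nat.pair b c, ?_⟩
    simp [hb, hb', hc, hc']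
  obtain ⟨f, hf, hf'⟩ := REPred.exists_computable_choice (P := fun p : ℕ × ℕ =>
    lo p.2.unpair.1 = lo p.1 ∧ hi p.2.unpair.1 = lo p.2.unpair.2 ∧ hi p.2.unpair.2 = hi p.1)
    (by fun_prop) hsplit
  exact ⟨⟨lo, hi, fun a => (f a).unpair.1, fun a => (f a).unpair.2, hlo, hhi, by fun_prop,
    by fun_prop, hwb, hex, fun a => (hf' a).1, fun a => (hf' a).2.1, fun a => (hf' a).2.2⟩⟩

/-- `A` meets the union of the list `F`. -/
def Hits (S : ERCS X) (A : Set X) (F : List ℕ) : Prop := (A ∩ (S.union F).carrier).Nonempty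

theorem Hits.mono {S : ERCS X} {A : Set X} {F G : List ℕ} (h : S.Hits A F)
    (hFG : S.WayBelow F (S.union G)) : S.Hits A G :=
  Set.Nonempty.mono (inter_subset_inter_right _ hFG.subset) h

namespace InterpolationSystem

variable {S : ERCS X} (I : S.InterpolationSystem)

/-- The pair that is reached from `a` by `m` splittings, where the choice between left and right
is made by the binary digits of `i`, starting with the one of weight `2 ^ (n - 1)`. -/
def descend (n a i m : ℕ) : ℕ :=
  Nat.rec a (fun k b => if i / 2 ^ (n - 1 - k) % 2 = 0 then I.left b else I.right b) m

/-- The `i`-th of the `2 ^ n` pairs into which `a` is split by `n` rounds of interpolation. -/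
def node (a n i : ℕ) : ℕ := I.descend n a i n

theorem descend_succ (n a i : ℕ) {m : ℕ} (hm : m ≤ n) :
    I.descend (n + 1) a i m = I.descend n a (i / 2) m := by
  induction m with
  | zero => rfl
  | succ m ih =>
    have h : i / 2 ^ (n + 1 - 1 - m) = i / 2 / 2 ^ (n - 1 - m) := by
      rw [Nat.div_div_eq_div_mul, ← pow_succ']
      congr 2
      omega
    change (if i / 2 ^ (n + 1 - 1 - m) % 2 = 0 then I.left (I.descend (n + 1) a i m) else
      I.right (I.descend (n + 1) a i m)) = if i / 2 / 2 ^ (n - 1 - m) % 2 = 0 then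
        I.left (I.descend n a (i / 2) m) else I.right (I.descend n a (i / 2) m)
    rw [ih (by omega), h]

theorem node_succ (a n i : ℕ) : I.node a (n + 1) i =
    if i % 2 = 0 then I.left (I.node a n (i / 2)) else I.right (I.node a n (i / 2)) := by
  change (if i / 2 ^ (n + 1 - 1 - n) % 2 = 0 then I.left (I.descend (n + 1) a i n) else
    I.right (I.descend (n + 1) a i n)) = _
  rw [I.descend_succ n a i le_rfl]
  simp [node]

variable {α : Type*} [Primcodable α]

@[fun_prop]
theorem comp_node {f g h : α → ℕ} (hf : Computable f) (hg : Computable g) (hh : Computable h) :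
    Computable fun a => I.node (f a) (g a) (h a) := by
  have := I.computable_left
  have := I.computable_right
  unfold node descend
  exact Computable.comp_natRec hg hf (by fun_prop)

/-- The chain `lo a = chain a n 0 ≪ chain a n 1 ≪ ⋯ ≪ chain a n (2 ^ n) = hi a` that `n` rounds of
interpolation yield, constant from the index `2 ^ n` on. -/
def chain (a n i : ℕ) : List ℕ := if i < 2 ^ n then I.lo (I.node a n i) else I.hi a

@[fun_prop]
theorem comp_chain {f g h : α → ℕ} (hf : Computable f) (hg : Computable g) (hh : Computable h) :
    Computable fun a => I.chain (f a) (g a) (h a) := by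
  have := I.computable_lo
  have := I.computable_hi
  unfold chain
  fun_prop

theorem chain_zero_zero (a : ℕ) : I.chain a 0 0 = I.lo a := by
  simp [chain, node, descend]

theorem chain_zero_one (a : ℕ) : I.chain a 0 1 = I.hi a := by
  simp [chain]

theorem hi_node (a n : ℕ) {i : ℕ} (hi : i < 2 ^ n) : I.hi (I.node a n i) = I.chain a n (i + 1) := by
  induction n generalizing i with
  | zero => simp [chain, node, descend]
  | succ n ih =>
    have hlt : i / 2 < 2 ^ n := by rw [pow_succ] at hi; omega
    rcases Nat.mod_two_eq_zero_or_one i with h | h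
    · have h1 : i + 1 < 2 ^ (n + 1) := by rw [pow_succ] at hi ⊢; omega
      have h2 : (i + 1) / 2 = i / 2 := by omega
      have h3 : (i + 1) % 2 = 1 := by omega
      rw [chain, if_pos h1, node_succ, node_succ, h2, if_pos h, h3, if_neg one_ne_zero, I.hi_left]
    · rw [node_succ, h, if_neg one_ne_zero, I.hi_right, ih hlt]
      have h2 : (i + 1) / 2 = i / 2 + 1 := by omega
      have h3 : (i + 1) % 2 = 0 := by omega
      unfold chain
      rw [node_succ, h2, if_pos h3, I.lo_left]
      exact if_congr (by rw [pow_succ]; omega) rfl rfl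

theorem wayBelow_chain (a n : ℕ) {i : ℕ} (hi : i < 2 ^ n) :
    S.WayBelow (I.chain a n i) (S.union (I.chain a n (i + 1))) := by
  rw [← I.hi_node a n hi, chain, if_pos hi]
  exact I.wayBelow _

theorem chain_succ_double (a n i : ℕ) : I.chain a (n + 1) (i * 2) = I.chain a n i := by
  unfold chain
  rw [node_succ, Nat.mul_mod_left, if_pos rfl, Nat.mul_div_cancel _ two_pos, I.lo_left]
  exact if_congr (by rw [pow_succ]; omega) rfl rfl

theorem chain_refine (a n k i : ℕ) : I.chain a (n + k) (i * 2 ^ k) = I.chain a n i := by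
  induction k with
  | zero => simp
  | succ k ih => rw [pow_succ, ← mul_assoc, ← add_assoc, chain_succ_double, ih]

theorem hits_chain_mono {A : Set X} {a n i j : ℕ} (hij : i ≤ j) (h : S.Hits A (I.chain a n i)) :
    S.Hits A (I.chain a n j) := by
  induction j, hij using Nat.le_induction with
  | base => exact h
  | succ j _ ih =>
    rcases lt_or_ge j (2 ^ n) with hj | hj
    · exact ih.mono (I.wayBelow_chain a n hj)
    · rw [chain, if_neg (by omega)] at ih ⊢
      exact ih

/-- The Urysohn function of the pair `a`, on the hyperspace: the infimum of the dyadic numbers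
`i / 2 ^ n` for which the `i`-th list of the `n`-th chain is hit. It is `0` where `lo a` is hit and
`1` where `hi a` is not hit. -/
noncomputable def urysohn (a : ℕ) (A : Set X) : ℝ :=
  sInf (insert 1 {r | ∃ n i : ℕ, S.Hits A (I.chain a n i) ∧ r = i / 2 ^ n})

theorem bddBelow_urysohn (a : ℕ) (A : Set X) :
    BddBelow (insert 1 {r : ℝ | ∃ n i : ℕ, S.Hits A (I.chain a n i) ∧ r = i / 2 ^ n}) := by
  refine ⟨0, ?_⟩
  rintro r (rfl | ⟨n, i, -, rfl⟩) <;> positivity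

theorem urysohn_nonneg (a : ℕ) (A : Set X) : 0 ≤ I.urysohn a A := by
  refine le_csInf (insert_nonempty _ _) ?_
  rintro r (rfl | ⟨n, i, -, rfl⟩) <;> positivity

theorem urysohn_le_one (a : ℕ) (A : Set X) : I.urysohn a A ≤ 1 :=
  csInf_le (I.bddBelow_urysohn a A) (mem_insert _ _)

theorem urysohn_le {a n i : ℕ} {A : Set X} (h : S.Hits A (I.chain a n i)) :
    I.urysohn a A ≤ i / 2 ^ n :=
  csInf_le (I.bddBelow_urysohn a A) (mem_insert_of_mem _ ⟨n, i, h, rfl⟩)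

theorem le_urysohn {a n i : ℕ} {A : Set X} (hi : i ≤ 2 ^ n) (h : ¬ S.Hits A (I.chain a n i)) :
    (i : ℝ) / 2 ^ n ≤ I.urysohn a A := by
  refine le_csInf (insert_nonempty _ _) ?_
  rintro r (rfl | ⟨m, j, hj, rfl⟩)
  · rw [div_le_one (by positivity)]
    exact_mod_cast hi
  · by_contra! hlt
    rw [div_lt_div_iff₀ (by positivity) (by positivity)] at hlt
    have hlt' : j * 2 ^ n < i * 2 ^ m := by exact_mod_cast hlt
    -- both members are members of the common refinement with `m + n` rounds
    rw [← I.chain_refine a m n j] at hj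
    rw [← I.chain_refine a n m i, add_comm n m] at h
    exact h (I.hits_chain_mono hlt'.le hj)

theorem urysohn_eq_zero {a : ℕ} {A : Set X} (h : S.Hits A (I.lo a)) : I.urysohn a A = 0 := by
  rw [← I.chain_zero_zero a] at h
  refine le_antisymm ?_ (I.urysohn_nonneg a A)
  simpa using I.urysohn_le h

theorem urysohn_eq_one {a : ℕ} {A : Set X} (h : ¬ S.Hits A (I.hi a)) : I.urysohn a A = 1 := by
  rw [← I.chain_zero_one a] at h
  refine le_antisymm (I.urysohn_le_one a A) ?_
  simpa using I.le_urysohn (by norm_num) h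

/-- The certificates by which the value of the Urysohn function is enclosed in an interval of
length `2 / 2 ^ n` exist: if `j` is the least index with a hit, then the list with index `j - 2`
is way below the complement of `A`, as it is way below the list with index `j - 1`, which `A`
misses. -/
theorem exists_urysohn_certificate (a n : ℕ) (A : ClosedOvert X) :
    ∃ j ≤ 2 ^ n, (j = 2 ^ n ∨ S.Hits A.carrier (I.chain a n j)) ∧
      (j < 2 ∨ S.WayBelow (I.chain a n (j - 2)) A.compl) := by
  classical
  have hex : ∃ j, j = 2 ^ n ∨ S.Hits A.carrier (I.chain a n j) := ⟨2 ^ n, Or.inl rfl⟩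
  have hle : Nat.find hex ≤ 2 ^ n := Nat.find_min' hex (Or.inl rfl)
  refine ⟨Nat.find hex, hle, Nat.find_spec hex, ?_⟩
  by_cases h2 : Nat.find hex < 2
  · exact Or.inl h2
  · refine Or.inr fun m hm => ?_
    obtain ⟨l, hl, hsub⟩ := I.wayBelow_chain a n (i := Nat.find hex - 2) (by omega) m hm
    refine ⟨l, hl, hsub.trans fun x hx hxA => ?_⟩
    have hmiss := Nat.find_min hex (m := Nat.find hex - 2 + 1) (by omega)
    exact hmiss (Or.inr ⟨x, hxA, hx⟩)

theorem abs_sub_urysohn_le {a n j : ℕ} {A : ClosedOvert X} (hj : j ≤ 2 ^ n)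
    (h1 : j = 2 ^ n ∨ S.Hits A.carrier (I.chain a n j))
    (h2 : j < 2 ∨ S.WayBelow (I.chain a n (j - 2)) A.compl) :
    |(j : ℝ) / 2 ^ n - I.urysohn a A.carrier| ≤ 2 / 2 ^ n := by
  have hup : I.urysohn a A.carrier ≤ j / 2 ^ n := by
    rcases h1 with rfl | h1
    · refine (I.urysohn_le_one a _).trans ?_
      rw [le_div_iff₀ (by positivity)]
      simp
    · exact I.urysohn_le h1
  have hlow : (j : ℝ) / 2 ^ n - 2 / 2 ^ n ≤ I.urysohn a A.carrier := by
    rw [← sub_div]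
    rcases lt_or_ge j 2 with hj2 | hj2
    · refine le_trans ?_ (I.urysohn_nonneg a _)
      refine div_nonpos_of_nonpos_of_nonneg ?_ (by positivity)
      have : (j : ℝ) ≤ 2 := by exact_mod_cast hj2.le
      linarith
    · rcases h2 with h2 | h2
      · omega
      have h := I.le_urysohn (a := a) (n := n) (i := j - 2) (A := A.carrier) (by omega)
        fun ⟨x, hxA, hx⟩ => h2.subset hx hxA
      rwa [Nat.cast_sub hj2] at h
  rw [abs_of_nonneg (by linarith)]
  linarith

end InterpolationSystem

end ERCS

end Urysohn

/-! ### The embedding of the hyperspace into the Hilbert cube -/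

section Embedding

namespace HilbertCube

theorem abs_coord_sub_le {p : ℕ → ℕ} {x : HilbertCube} (hp : IsName p x) (k i : ℕ) :
    |(gridNum (p k) i : ℝ) / 2 ^ (gridLen (p k) + i) - x.coord i| ≤ 1 / 2 ^ k := by
  have h := (dist_le (by positivity)).1 (hp k) i
  rwa [one_div, inv_pow, ← one_div] at h

theorem coord_pos_iff {p : ℕ → ℕ} {x : HilbertCube} (hp : IsName p x) (i : ℕ) :
    0 < x.coord i ↔ ∃ k, 2 ^ (gridLen (p k) + i) < gridNum (p k) i * 2 ^ k := by
  have hiff : ∀ k, 2 ^ (gridLen (p k) + i) < gridNum (p k) i * 2 ^ k ↔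
      (1 : ℝ) / 2 ^ k < gridNum (p k) i / 2 ^ (gridLen (p k) + i) := fun k => by
    rw [div_lt_div_iff₀ (by positivity) (by positivity), one_mul]
    exact_mod_cast Iff.rfl
  simp only [hiff]
  constructor
  · intro h
    obtain ⟨k, hk⟩ := exists_pow_lt_of_lt_one (half_pos h) (show (1 / 2 : ℝ) < 1 by norm_num)
    rw [one_div, inv_pow, ← one_div] at hk
    have := abs_le.1 (abs_coord_sub_le hp k i)
    exact ⟨k, by linarith⟩
  · rintro ⟨k, hk⟩
    have := abs_le.1 (abs_coord_sub_le hp k i)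
    linarith

theorem coord_lt_iff {p : ℕ → ℕ} {x : HilbertCube} (hp : IsName p x) (i : ℕ) :
    x.coord i < 1 / 2 ^ i ↔ ∃ k, gridNum (p k) i * 2 ^ k + 2 ^ (gridLen (p k) + i) <
      2 ^ (gridLen (p k) + k) := by
  have hiff : ∀ k, gridNum (p k) i * 2 ^ k + 2 ^ (gridLen (p k) + i) < 2 ^ (gridLen (p k) + k) ↔
      (gridNum (p k) i : ℝ) / 2 ^ (gridLen (p k) + i) + 1 / 2 ^ k < 1 / 2 ^ i := fun k => by
    have h : (2 : ℝ) ^ (gridLen (p k) + i) * 2 ^ k = 2 ^ (gridLen (p k) + k) * 2 ^ i := by ring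
    rw [div_add_div _ _ (by positivity) (by positivity), div_lt_div_iff₀ (by positivity)
      (by positivity), mul_one, one_mul, h, mul_lt_mul_iff_left₀ (by positivity)]
    exact_mod_cast Iff.rfl
  simp only [hiff]
  constructor
  · intro h
    obtain ⟨k, hk⟩ := exists_pow_lt_of_lt_one (half_pos (sub_pos.2 h))
      (show (1 / 2 : ℝ) < 1 by norm_num)
    rw [one_div, inv_pow, ← one_div] at hk
    have := abs_le.1 (abs_coord_sub_le hp k i)
    exact ⟨k, by linarith⟩
  · rintro ⟨k, hk⟩
    have := abs_le.1 (abs_coord_sub_le hp k i)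
    linarith

end HilbertCube

variable {X : Type u} [RepresentedSpace X]

namespace ERCS

variable {S : ERCS X}

theorem mem_iff_exists_nameUnion {F : List ℕ} {q : ℕ → ℕ} {x : X} (hq : IsName q x) :
    x ∈ (S.union F).carrier ↔ ∃ k, S.nameUnion F (Encodable.encode (initSeg q k)) ≠ 0 :=
  OpenSet.mem_iff_of_isName (S.isName_nameUnion F) hq

variable (S) in
/-- The word `w`, read as the beginning of a name of the open set of all open sets that hit a
closed set, suffices for a proof that this closed set hits the union of the list `F`. -/
def HitsWord (F w : List ℕ) : Prop :=
  ∃ k, Encodable.encode (initSeg (S.nameUnion F) k) < w.length ∧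
    w.getD (Encodable.encode (initSeg (S.nameUnion F) k)) 0 ≠ 0

theorem comp_hitsWord {α : Type*} [Primcodable α] {f g : α → List ℕ} (hf : Computable f)
    (hg : Computable g) : REPred fun a => S.HitsWord (f a) (g a) := by
  unfold HitsWord
  fun_prop

theorem hitsWord_mono {F : List ℕ} {v : ℕ → ℕ} {j k : ℕ} (hjk : j ≤ k)
    (h : S.HitsWord F (initSeg v j)) : S.HitsWord F (initSeg v k) := by
  obtain ⟨l, hl, h⟩ := h
  rw [getD_initSeg (by rwa [length_initSeg] at hl)] at h
  rw [length_initSeg] at hl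
  exact ⟨l, by rw [length_initSeg]; omega, by rwa [getD_initSeg (by omega)]⟩

theorem hits_iff {F : List ℕ} {A : ClosedOvert X} {v : ℕ → ℕ} (hv : IsName v A.hits) :
    S.Hits A.carrier F ↔ ∃ k, S.HitsWord F (initSeg v k) := by
  have h := OpenSet.mem_iff_of_isName hv (S.isName_nameUnion F)
  refine h.trans ⟨?_, ?_⟩
  · rintro ⟨k, hk⟩
    refine ⟨Encodable.encode (initSeg (S.nameUnion F) k) + 1, k, ?_, ?_⟩
    · rw [length_initSeg]; exact Nat.lt_succ_self _
    · rwa [getD_initSeg (Nat.lt_succ_self _)]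
  · rintro ⟨K, k, hk, h⟩
    rw [length_initSeg] at hk
    exact ⟨k, by rwa [getD_initSeg hk] at h⟩

namespace InterpolationSystem

variable (I : S.InterpolationSystem)

/-- The map of the hyperspace into the Hilbert cube whose coordinates are the Urysohn functions. -/
noncomputable def toCube (A : ClosedOvert X) : HilbertCube :=
  HilbertCube.ofCoord (fun a => I.urysohn a A.carrier / 2 ^ a) fun a => by
    refine ⟨div_nonneg (I.urysohn_nonneg a _) (by positivity), ?_⟩
    rw [one_div, inv_pow, ← one_div]
    exact div_le_div_of_nonneg_right (I.urysohn_le_one a _) (by positivity)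

theorem coord_toCube (A : ClosedOvert X) (a : ℕ) :
    (I.toCube A).coord a = I.urysohn a A.carrier / 2 ^ a := rfl

open HilbertCube in
theorem computableMap_toCube : ComputableMap I.toCube := by
  let C : List ℕ → ℕ → ℕ → ℕ → Prop := fun u n a j =>
    (j = 2 ^ n ∨ S.HitsWord (I.chain a n j) (oddWord u)) ∧
      (j < 2 ∨ S.WayBelowWord (I.chain a n (j - 2)) (evenWord u))
  have hC : REPred fun q : ((List ℕ × ℕ) × ℕ) × ℕ =>
      C q.1.1.1 (q.1.1.2 + 1) q.2 (gridNum q.1.2 q.2) := by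
    simp only [C]
    exact REPred.comp_and (REPred.comp_or (by fun_prop) (comp_hitsWord (by fun_prop) (by fun_prop)))
      (by fun_prop)
  have hP : REPred fun q : (List ℕ × ℕ) × ℕ => gridLen q.2 = q.1.2 + 1 ∧
      ∀ a < q.1.2 + 1, C q.1.1 (q.1.2 + 1) a (gridNum q.2 a) :=
    REPred.comp_and (by fun_prop) (REPred.comp_ball (by fun_prop) hC)
  obtain ⟨φ, hφ, H⟩ := hP.exists_computes
  refine ⟨φ, hφ, fun p A hp => ?_⟩
  have hodd : ∀ F, S.Hits A.carrier F ↔ ∃ k, S.HitsWord F (initSeg (oddPart p) k) :=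
    fun F => hits_iff hp.2
  have heven : ∀ F, S.WayBelow F A.compl ↔ ∃ k, S.WayBelowWord F (initSeg (evenPart p) k) :=
    fun F => wayBelow_iff hp.1
  obtain ⟨q, hq, hq'⟩ := H p fun n => by
    choose j hj hj1 hj2 using fun a => I.exists_urysohn_certificate a (n + 1) A
    have hk : ∀ a, ∃ k, ∀ K, k ≤ K → C (initSeg p (2 * K)) (n + 1) a (j a) := by
      intro a
      have h1 : ∃ k, ∀ K, k ≤ K → (j a = 2 ^ (n + 1) ∨
          S.HitsWord (I.chain a (n + 1) (j a)) (initSeg (oddPart p) K)) := by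
        rcases hj1 a with h | h
        · exact ⟨0, fun _ _ => Or.inl h⟩
        · obtain ⟨k, hk⟩ := (hodd _).1 h
          exact ⟨k, fun K hK => Or.inr (hitsWord_mono hK hk)⟩
      have h2 : ∃ k, ∀ K, k ≤ K → (j a < 2 ∨
          S.WayBelowWord (I.chain a (n + 1) (j a - 2)) (initSeg (evenPart p) K)) := by
        rcases hj2 a with h | h
        · exact ⟨0, fun _ _ => Or.inl h⟩
        · obtain ⟨k, hk⟩ := (heven _).1 h
          exact ⟨k, fun K hK => Or.inr (wayBelowWord_mono hK hk)⟩
      obtain ⟨k, hk⟩ := h1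
      obtain ⟨l, hl⟩ := h2
      refine ⟨max k l, fun K hK => ?_⟩
      simp only [C, oddWord_initSeg, evenWord_initSeg, Nat.mul_div_cancel_left _ two_pos]
      exact ⟨hk K (le_trans (le_max_left _ _) hK), hl K (le_trans (le_max_right _ _) hK)⟩
    choose k hk using hk
    have hlen : gridLen (Encodable.encode (initSeg j (n + 1))) = n + 1 := by
      rw [gridLen, Denumerable.ofNat_encode, length_initSeg]
    refine ⟨2 * (Finset.range (n + 1)).sup k, Encodable.encode (initSeg j (n + 1)), hlen,
      fun a ha => ?_⟩
    have hnum : gridNum (Encodable.encode (initSeg j (n + 1))) a = j a := by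
      rw [gridNum, hlen, Denumerable.ofNat_encode, getD_initSeg ha, min_eq_left (hj a)]
    simp only [hnum]
    exact hk a _ (Finset.le_sup (f := k) (Finset.mem_range.2 ha))
  refine ⟨q, hq, isName_iff.2 fun n => ?_⟩
  obtain ⟨K, hlen, hcert⟩ := hq' n
  refine dist_gridPt_le hlen fun a ha => ?_
  rw [coord_toCube, mul_div_cancel₀ _ (by positivity)]
  obtain ⟨h1, h2⟩ := hcert a ha
  simp only [oddWord_initSeg, evenWord_initSeg] at h1 h2
  have hle : gridNum (q n) a ≤ 2 ^ (n + 1) := by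
    have : gridLen (q n) = n + 1 := hlen
    rw [gridNum, this]
    exact min_le_right _ _
  have h := I.abs_sub_urysohn_le hle (h1.imp_right fun h => (hodd _).2 ⟨_, h⟩)
    (h2.imp_right fun h => (heven _).2 ⟨_, h⟩)
  have h3 : (2 : ℝ) / 2 ^ (n + 1) = (1 / 2) ^ n := by
    rw [one_div, inv_pow, pow_succ]
    field_simp
  rwa [h3] at h

theorem mem_compl_iff {A : ClosedOvert X} {x : X} : x ∈ A.compl.carrier ↔
    ∃ a, 0 < (I.toCube A).coord a ∧ x ∈ (S.union (I.lo a)).carrier := by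
  simp only [coord_toCube]
  constructor
  · intro hx
    obtain ⟨m, hm, hxm⟩ := exists_wayBelow_singleton (S := S) hx
    obtain ⟨G, h1, h2⟩ := hm.interpolate
    obtain ⟨a, ha, ha'⟩ := I.exists_eq _ _ h1
    refine ⟨a, ?_, ?_⟩
    · rw [I.urysohn_eq_one]
      · positivity
      · rintro ⟨y, hyA, hy⟩
        rw [ha'] at hy
        exact h2.subset hy hyA
    · rw [ha]
      exact S.mem_union.2 ⟨m, List.mem_singleton_self m, hxm⟩
  · rintro ⟨a, ha, hx⟩ hxA
    rw [I.urysohn_eq_zero ⟨x, hxA, hx⟩, zero_div] at ha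
    exact lt_irrefl _ ha

theorem mem_hits_iff {A : ClosedOvert X} {V : OpenSet X} : V ∈ A.hits.carrier ↔
    ∃ a, (I.toCube A).coord a < 1 / 2 ^ a ∧ S.WayBelow (I.hi a) V := by
  simp only [coord_toCube]
  constructor
  · rintro ⟨x, hxA, hxV⟩
    obtain ⟨m, hm, hxm⟩ := exists_wayBelow_singleton (S := S) hxV
    obtain ⟨G, h1, h2⟩ := hm.interpolate
    obtain ⟨a, ha, ha'⟩ := I.exists_eq _ _ h1
    refine ⟨a, ?_, by rwa [ha']⟩
    rw [I.urysohn_eq_zero, zero_div]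
    · positivity
    · rw [ha]
      exact ⟨x, hxA, S.mem_union.2 ⟨m, List.mem_singleton_self m, hxm⟩⟩
  · rintro ⟨a, ha, hV⟩
    by_contra hmiss
    rw [I.urysohn_eq_one] at ha
    · exact lt_irrefl _ ha
    · rintro ⟨x, hxA, hx⟩
      exact hmiss ⟨x, hxA, hV.subset hx⟩

open HilbertCube in
theorem computableEmbedding_toCube : ComputableEmbedding I.toCube := by
  refine ⟨fun A B h => ?_, I.computableMap_toCube, ?_⟩
  · refine ClosedOvert.ext (compl_injective (Set.ext fun x => ?_))
    change x ∈ A.compl.carrier ↔ x ∈ B.compl.carrier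
    rw [I.mem_compl_iff, I.mem_compl_iff, h]
  · have := I.computable_lo
    have := I.computable_hi
    have h0 : REPred fun w : List ℕ × List ℕ => ∃ a,
        (∃ k < w.1.length,
          2 ^ (gridLen (w.1.getD k 0) + a) < gridNum (w.1.getD k 0) a * 2 ^ k) ∧
        ∃ k < w.2.length + 1, S.nameUnion (I.lo a) (Encodable.encode (w.2.take k)) ≠ 0 := by
      fun_prop
    have h1 : REPred fun w : List ℕ × List ℕ => ∃ a,
        (∃ k < w.1.length, gridNum (w.1.getD k 0) a * 2 ^ k + 2 ^ (gridLen (w.1.getD k 0) + a) <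
          2 ^ (gridLen (w.1.getD k 0) + k)) ∧ S.WayBelowWord (I.hi a) w.2 := by
      fun_prop
    obtain ⟨φ, hφ, H⟩ := h0.exists_computes_pair h1
    refine ⟨φ, hφ, fun p A hp => ?_⟩
    obtain ⟨q, hq, hq0, hq1⟩ := H p
    refine ⟨q, hq, fun r x hr => ?_, fun r V hr => ?_⟩
    · rw [hq0, I.mem_compl_iff]
      simp only [coord_pos_iff hp, mem_iff_exists_nameUnion hr, length_initSeg, take_initSeg]
      constructor
      · rintro ⟨a, ⟨k, hk⟩, l, hl⟩
        exact ⟨k + 1, l, a, ⟨k, Nat.lt_succ_self k, by rwa [getD_initSeg (Nat.lt_succ_self k)]⟩,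
          l, Nat.lt_succ_self l, by rwa [min_self]⟩
      · rintro ⟨j, l, a, ⟨k, hkj, hk⟩, i, -, hi⟩
        rw [getD_initSeg hkj] at hk
        exact ⟨a, ⟨k, hk⟩, _, hi⟩
    · rw [hq1, I.mem_hits_iff]
      simp only [coord_lt_iff hp, wayBelow_iff hr, length_initSeg]
      constructor
      · rintro ⟨a, ⟨k, hk⟩, l, hl⟩
        exact ⟨k + 1, l, a, ⟨k, Nat.lt_succ_self k, by rwa [getD_initSeg (Nat.lt_succ_self k)]⟩, hl⟩
      · rintro ⟨j, l, a, ⟨k, hkj, hk⟩, hl⟩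
        rw [getD_initSeg hkj] at hk
        exact ⟨a, ⟨k, hk⟩, l, hl⟩

end InterpolationSystem

end ERCS

end Embedding

theorem corollary32 (X : Type*) [RepresentedSpace X] (h : Nonempty (ERCS X)) :
    ComputablyMetrizable (ClosedOvert X) := by
  obtain ⟨S⟩ := h
  obtain ⟨I⟩ := S.nonempty_interpolationSystem
  exact I.computableEmbedding_toCube.computablyMetrizable
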